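/- Consider elections with $m$ candidates and $n\ge 1$ votes, each vote being a ranking (complete order) of the candidates; votes may be repeated. For rankings $\pi,\sigma$ let $\mathrm{d}_{\mathrm{KT}}(\pi,\sigma)$ be their Kendall–Tau distance, i.e. the number of pairs of candidates that they order differently. For a list of votes $\Pi=(v_1,\dots,v_n)$, the Kemeny score of a ranking $Q$ is $\sum_{i=1}^n \mathrm{d}_{\mathrm{KT}}(Q,v_i)$; let $K(\Pi)$ be the set of Kemeny rankings, i.e. rankings of minimum Kemeny score. Let $$d=d(\Pi)=\frac{\sum_{i=1}^n\sum_{j=1}^n \mathrm{d}_{\mathrm{KT}}(v_i,v_j)}{n(n-1)}$$ be the average Kendall–Tau distance of the votes ($d=0$ if $n=1$). In the problem Distinct OPT Kemeny Ranking Aggregation one is given the candidates, the votes $\Pi$ and an integer $r\ge 0$, and has to output $\min\{r,|K(\Pi)|\}$ distinct Kemeny rankings of $\Pi$. **Theorem.** Distinct OPT Kemeny Ranking Aggregation is fixed-parameter tractable parameterized by $d$, with running time $\mathcal{O}^*(16^d)$. That is, there are an algorithm (a program for a random access machine with logarithmic cost) and a polynomial $q$ such that on every instance, with input of $N$ bits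 ($r$ being written in binary), the algorithm halts after time at most $16^{d}\cdot q(N)$ and outputs $\min\{r,|K(\Pi)|\}$ distinct Kemeny rankings of $\Pi$. -/

import Mathlib

/-! ## Rankings, the Kendall–Tau distance and the Kemeny rule -/

namespace Kemeny

/-- A ranking (complete order) of the candidates `0, …, m - 1`, given by positions: `π c` is the
number of candidates that are preferred to `c`, so `a` is preferred to `b` iff `π a < π b`. -/
abbrev Ranking (m : ℕ) : Type := Equiv.Perm (Fin m)

/-- Kendall–Tau distance: the number of unordered pairs of candidates that are ordered differently
by `π` and `σ`. Each such pair is counted once, in the order in which `π` ranks it. -/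
def kendallTau {m : ℕ} (π σ : Ranking m) : ℕ :=
  (Finset.univ.filter fun p : Fin m × Fin m => π p.1 < π p.2 ∧ σ p.2 < σ p.1).card

/-- Kemeny score of `Q` for the votes `V` (a list, so that votes may be repeated). -/
def kemenyScore {m : ℕ} (V : List (Ranking m)) (Q : Ranking m) : ℕ :=
  (V.map fun v => kendallTau Q v).sum

/-- The set of all (optimal) Kemeny rankings. -/
def kemenyRankings {m : ℕ} (V : List (Ranking m)) : Finset (Ranking m) :=
  Finset.univ.filter fun Q => ∀ Q' : Ranking m, kemenyScore V Q ≤ kemenyScore V Q'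

/-- Average Kendall–Tau distance
`(∑ v ∈ V, ∑ w ∈ V, kendallTau v w) / (n * (n - 1))`, where `n` is the number of votes.
For a single vote it is `0`. -/
noncomputable def avgKT {m : ℕ} (V : List (Ranking m)) : ℝ :=
  (V.map fun v => (V.map fun w => (kendallTau v w : ℝ)).sum).sum /
    ((V.length : ℝ) * ((V.length : ℝ) - 1))

/-- `L` is a correct answer for the instance with votes `V` and bound `r`: a list of
`min r |K(V)|` distinct Kemeny rankings. -/
def IsAnswer {m : ℕ} (V : List (Ranking m)) (r : ℕ) (L : List (Ranking m)) : Prop :=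
  L.Nodup ∧ (∀ π ∈ L, π ∈ kemenyRankings V) ∧ L.length = min r (kemenyRankings V).card

/-! ### Encoding as sequences of natural numbers -/

/-- The candidates in order of preference, the most preferred one first. -/
def encodeRanking {m : ℕ} (π : Ranking m) : List ℕ :=
  List.ofFn fun i : Fin m => ((π.symm i : Fin m) : ℕ)

/-- Input: number of candidates, number of votes, number of requested rankings, then the votes. -/
def encodeInstance {m : ℕ} (V : List (Ranking m)) (r : ℕ) : List ℕ :=
  [m, V.length, r] ++ V.flatMap encodeRanking

/-- Output: the rankings one after the other, each preceded by its length. -/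
def encodeAnswer {m : ℕ} (L : List (Ranking m)) : List ℕ :=
  L.flatMap fun π => m :: encodeRanking π

/-- Size of a sequence of naturals written in binary, with one separator per number. -/
def bitSize (l : List ℕ) : ℕ := (l.map fun x => Nat.size x + 1).sum

end Kemeny

/-! ## Random access machines with logarithmic cost

Memory cells indexed by `ℕ` hold natural numbers; there is a read-only input sequence and a
write-only output sequence. Every elementary operation is charged one unit plus the binary lengths
of the addresses and of the values it handles. -/

namespace RAM

/-- Arithmetic expressions; `cell a` is the content of the cell whose address is the value of `a`,
and `sub` is truncated subtraction. -/
inductive Expr : Type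
  | lit (c : ℕ)
  | cell (a : Expr)
  | add (a b : Expr)
  | sub (a b : Expr)
  | mul (a b : Expr)

/-- Value of an expression in the memory `μ`. -/
def Expr.eval (μ : ℕ → ℕ) : Expr → ℕ
  | .lit c => c
  | .cell a => μ (a.eval μ)
  | .add a b => a.eval μ + b.eval μ
  | .sub a b => a.eval μ - b.eval μ
  | .mul a b => a.eval μ * b.eval μ

/-- Logarithmic cost of evaluating an expression in the memory `μ`. -/
def Expr.cost (μ : ℕ → ℕ) : Expr → ℕ
  | .lit c => 1 + Nat.size c
  | .cell a => a.cost μ + (1 + Nat.size (a.eval μ) + Nat.size (μ (a.eval μ)))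
  | .add a b => a.cost μ + b.cost μ + (1 + Nat.size (a.eval μ) + Nat.size (b.eval μ))
  | .sub a b => a.cost μ + b.cost μ + (1 + Nat.size (a.eval μ) + Nat.size (b.eval μ))
  | .mul a b => a.cost μ + b.cost μ + (1 + Nat.size (a.eval μ) + Nat.size (b.eval μ))

/-- Programs. `assign a e` stores the value of `e` in the cell with address `a`; `read a` moves the
next input number to the cell with address `a` (`0` when the input is exhausted); `write e` appends
the value of `e` to the output; conditions hold when the value of the expression is not `0`. -/
inductive Program : Type
  | skip
  | assign (a e : Expr)
  | read (a : Expr)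
  | write (e : Expr)
  | seq (p q : Program)
  | ite (e : Expr) (p q : Program)
  | loop (e : Expr) (p : Program)

/-- State of the machine: memory, unread input, output written so far. -/
structure State : Type where
  mem : ℕ → ℕ
  inp : List ℕ
  out : List ℕ

/-- `Exec p s s' t`: started in state `s`, the program `p` halts in state `s'` at total cost `t`. -/
inductive Exec : Program → State → State → ℕ → Prop
  | skip (s : State) : Exec .skip s s 1
  | assign (a e : Expr) (s : State) :
      Exec (.assign a e) s
        { s with mem := Function.update s.mem (a.eval s.mem) (e.eval s.mem) }
        (a.cost s.mem + e.cost s.mem +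
          (1 + Nat.size (a.eval s.mem) + Nat.size (e.eval s.mem)))
  | read (a : Expr) (s : State) :
      Exec (.read a) s
        { s with
          mem := Function.update s.mem (a.eval s.mem) (s.inp.headD 0)
          inp := s.inp.tail }
        (a.cost s.mem + (1 + Nat.size (a.eval s.mem) + Nat.size (s.inp.headD 0)))
  | write (e : Expr) (s : State) :
      Exec (.write e) s { s with out := s.out ++ [e.eval s.mem] }
        (e.cost s.mem + (1 + Nat.size (e.eval s.mem)))
  | seq {p q : Program} {s₁ s₂ s₃ : State} {t₁ t₂ : ℕ} :
      Exec p s₁ s₂ t₁ → Exec q s₂ s₃ t₂ → Exec (.seq p q) s₁ s₃ (t₁ + t₂)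
  | ite_true {e : Expr} {p q : Program} {s s' : State} {t : ℕ} :
      e.eval s.mem ≠ 0 → Exec p s s' t →
        Exec (.ite e p q) s s' (e.cost s.mem + (1 + Nat.size (e.eval s.mem)) + t)
  | ite_false {e : Expr} {p q : Program} {s s' : State} {t : ℕ} :
      e.eval s.mem = 0 → Exec q s s' t → Exec (.ite e p q) s s' (e.cost s.mem + 1 + t)
  | loop_true {e : Expr} {p : Program} {s₁ s₂ s₃ : State} {t₁ t₂ : ℕ} :
      e.eval s₁.mem ≠ 0 → Exec p s₁ s₂ t₁ → Exec (.loop e p) s₂ s₃ t₂ →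
        Exec (.loop e p) s₁ s₃ (e.cost s₁.mem + (1 + Nat.size (e.eval s₁.mem)) + t₁ + t₂)
  | loop_false {e : Expr} {p : Program} {s : State} :
      e.eval s.mem = 0 → Exec (.loop e p) s s (e.cost s.mem + 1)

/-- The machine is deterministic: the final state and the running time are unique. -/
theorem Exec.deterministic {p : Program} {s s₁ s₂ : State} {t₁ t₂ : ℕ}
    (h₁ : Exec p s s₁ t₁) (h₂ : Exec p s s₂ t₂) : s₁ = s₂ ∧ t₁ = t₂ := by
  induction h₁ generalizing s₂ t₂ with
  | skip | assign | read | write => cases h₂; exact ⟨rfl, rfl⟩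
  | seq _ _ ih₁ ih₂ =>
    cases h₂ with
    | seq a b =>
      obtain ⟨rfl, rfl⟩ := ih₁ a
      obtain ⟨rfl, rfl⟩ := ih₂ b
      exact ⟨rfl, rfl⟩
  | ite_true h _ ih =>
    cases h₂ with
    | ite_true _ a => obtain ⟨rfl, rfl⟩ := ih a; exact ⟨rfl, rfl⟩
    | ite_false h' _ => exact absurd h' h
  | ite_false h _ ih =>
    cases h₂ with
    | ite_true h' _ => exact absurd h h'
    | ite_false _ a => obtain ⟨rfl, rfl⟩ := ih a; exact ⟨rfl, rfl⟩
  | loop_true h _ _ ih₁ ih₂ =>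
    cases h₂ with
    | loop_true _ a b =>
      obtain ⟨rfl, rfl⟩ := ih₁ a
      obtain ⟨rfl, rfl⟩ := ih₂ b
      exact ⟨rfl, rfl⟩
    | loop_false h' => exact absurd h' h
  | loop_false h =>
    cases h₂ with
    | loop_true h' _ _ => exact absurd h h'
    | loop_false _ => exact ⟨rfl, rfl⟩

/-- On input `x`, with all memory cells initially `0`, the program halts with output `y` after
running time `t`. -/
def Computes (p : Program) (x y : List ℕ) (t : ℕ) : Prop :=
  ∃ s : State, Exec p ⟨fun _ => 0, x, []⟩ s t ∧ s.out = y

end RAM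

/-! A ranking is built from the top down. Placing `c` next costs one unit for every vote and every
unplaced candidate which that vote prefers to `c`; for a complete ranking these costs add up to the
Kemeny score (`prefixCost_chosen`). The search tree branches over the next candidate under two
restrictions: a Condorcet winner of the unplaced candidates, if there is one, must come next, and
the accumulated cost may not exceed a budget `B`. An exchange argument (`isNode_of_minimal`) shows
that these restrictions lose no Kemeny ranking once `B` is at least the optimal score. For smaller
budgets there is no complete ranking in the tree, and for `B` equal to the optimum the complete ones
are exactly the Kemeny rankings (`leaves_eq_nil`, `mem_leaves_iff`). So the program raises `B` from
`0` until a complete ranking appears.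

The tree is small because of the potential `16 ^ ((B - cost) / n)`, which summed over the children
of a node does not exceed its value at the node (`sum_choices_le_one`). A single forced choice is
clear. Without a Condorcet winner, let `x` be the step cost of `c` divided by `n`. Some rival of `c`
is preferred to it by at least half of the votes, so `x ≥ 1/2` and `16 ^ (-x) ≤ 1/2 * 4 ^ (-x)`.
Since `x` is the average over the votes of the rank of `c` among the unplaced candidates, Jensen's
inequality bounds `4 ^ (-x)` by the average of `4 ^ (-rank)`. Within one vote the ranks are
distinct, so the sum over `c` is at most `4/3`, and the children have total weight at most `2/3`.
Hence a tree of depth `m` with budget at most `opt` has at most `(m + 1) * 16 ^ (opt / n)` nodes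
(`treeSize_le`), and `opt / n ≤ d` because no vote, taken as a ranking, has score below `opt`
(`kemenyScore_div_le_avgKT`).

The rest is an implementation. A small program logic counts elementary operations while all stored
numbers stay below a bound `X`. The tree is searched breadth first with a queue in memory, and the
number of rounds, the work per node and the cost per operation are all polynomial in the input size.
-/

namespace RAM

/-! ## A program logic with time bounds -/

/-- If all memory cells have binary length less than `w`, then the value of the expression has
binary length at most `width * w`. -/
def Expr.width : Expr → ℕ
  | .lit c => c
  | .cell _ => 1
  | .add a b => a.width + b.width + 1
  | .sub a _ => a.width
  | .mul a b => a.width + b.width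

/-- If all memory cells have binary length less than `w`, then evaluating the expression costs at
most `weight * w`. -/
def Expr.weight : Expr → ℕ
  | .lit c => 1 + c
  | .cell a => a.weight + (1 + a.width + 1)
  | .add a b => a.weight + b.weight + (1 + a.width + b.width)
  | .sub a b => a.weight + b.weight + (1 + a.width + b.width)
  | .mul a b => a.weight + b.weight + (1 + a.width + b.width)

theorem size_add_le (x y : ℕ) : Nat.size (x + y) ≤ Nat.size x + Nat.size y + 1 := by
  rw [Nat.size_le]
  have hx := Nat.lt_size_self x
  have hy := Nat.lt_size_self y
  have h1 : 2 ^ x.size ≤ 2 ^ (x.size + y.size) := Nat.pow_le_pow_right (by norm_num) (by omega)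
  have h2 : 2 ^ y.size ≤ 2 ^ (x.size + y.size) := Nat.pow_le_pow_right (by norm_num) (by omega)
  rw [pow_succ]
  omega

theorem size_mul_le (x y : ℕ) : Nat.size (x * y) ≤ Nat.size x + Nat.size y := by
  rw [Nat.size_le, pow_add]
  exact Nat.mul_lt_mul'' (Nat.lt_size_self x) (Nat.lt_size_self y)

theorem Expr.size_eval_le {μ : ℕ → ℕ} {w : ℕ} (hw : 1 ≤ w) (hμ : ∀ a, Nat.size (μ a) ≤ w)
    (e : Expr) : Nat.size (e.eval μ) ≤ e.width * w := by
  induction e with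
  | lit c =>
    simp only [eval, width]
    exact (Nat.size_le.2 Nat.lt_two_pow_self).trans (Nat.le_mul_of_pos_right c hw)
  | cell a => simpa [eval, width] using hμ _
  | add a b iha ihb =>
    have := size_add_le (a.eval μ) (b.eval μ)
    simp only [eval, width, add_mul]
    omega
  | sub a b iha ihb =>
    exact (Nat.size_le_size (Nat.sub_le _ _)).trans iha
  | mul a b iha ihb =>
    have := size_mul_le (a.eval μ) (b.eval μ)
    simp only [eval, width, add_mul]
    omega

theorem Expr.cost_le {μ : ℕ → ℕ} {w : ℕ} (hw : 1 ≤ w) (hμ : ∀ a, Nat.size (μ a) ≤ w)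
    (e : Expr) : e.cost μ ≤ e.weight * w := by
  induction e with
  | lit c =>
    simp only [cost, weight]
    have : Nat.size c ≤ c := Nat.size_le.2 Nat.lt_two_pow_self
    exact (by omega : 1 + Nat.size c ≤ 1 + c).trans (Nat.le_mul_of_pos_right _ hw)
  | cell a iha =>
    have h1 := a.size_eval_le hw hμ
    have h2 := hμ (a.eval μ)
    simp only [cost, weight, add_mul]
    omega
  | add a b iha ihb | sub a b iha ihb | mul a b iha ihb =>
    have h1 := a.size_eval_le hw hμ
    have h2 := b.size_eval_le hw hμ
    simp only [cost, weight, add_mul]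
    omega

/-! ### Program variables, memory layout and Hoare triples. -/

/-- The variables of the search program. -/
structure Store : Type where
  m : ℕ
  n : ℕ
  r : ℕ
  i : ℕ
  j : ℕ
  k : ℕ
  bud : ℕ
  go : ℕ
  head : ℕ
  tail : ℕ
  win : ℕ
  acc : ℕ
  seq : ℕ → ℕ
  pref : ℕ → ℕ
  pos : ℕ → ℕ
  len : ℕ → ℕ
  cst : ℕ → ℕ
  inp : List ℕ
  out : List ℕ

namespace Store

/-- The scalar variables. -/
def scalar (s : Store) : ℕ → ℕ
  | 0 => s.m
  | 1 => s.n
  | 2 => s.r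
  | 3 => s.i
  | 4 => s.j
  | 5 => s.k
  | 6 => s.bud
  | 7 => s.go
  | 8 => s.head
  | 9 => s.tail
  | 10 => s.win
  | 11 => s.acc
  | _ => 0

/-- The arrays; the scalars make up the array `0`. -/
def array (s : Store) : ℕ → ℕ → ℕ
  | 0 => s.scalar
  | 1 => s.seq
  | 2 => s.pref
  | 3 => s.pos
  | 4 => s.len
  | 5 => s.cst
  | _ => fun _ => 0

/-- Memory layout: the arrays are interleaved. -/
def mem (s : Store) (a : ℕ) : ℕ := s.array (a % 8) (a / 8)

/-- The machine state that is described by `s`. -/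
def state (s : Store) : State := ⟨s.mem, s.inp, s.out⟩

end Store

/-- Entry `e` of the array number `a`. -/
def entry (a : ℕ) (e : Expr) : Expr := .add (.mul (.lit 8) e) (.lit a)

/-- Scalar variable number `q`. -/
def var (q : ℕ) : Expr := .cell (.lit (8 * q))

/-- All numbers in the memory and in the remaining input are at most `X`. -/
def Store.Bounded (X : ℕ) (s : Store) : Prop := (∀ a, s.mem a ≤ X) ∧ ∀ x ∈ s.inp, x ≤ X

/-- An upper bound for the cost of an elementary operation of the search program. -/
def opCost (X : ℕ) : ℕ := 10000 * (Nat.size X + 1)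

/-- From `s`, the program `p` reaches a state with the property `Q`, in at most `k` elementary
operations, and all numbers stay at most `X`. -/
def Reaches (X : ℕ) (p : Program) (s : Store) (k : ℕ) (Q : Store → Prop) : Prop :=
  s.Bounded X → ∃ (s' : Store) (t : ℕ),
    Exec p s.state s'.state t ∧ t ≤ k * opCost X ∧ s'.Bounded X ∧ Q s'

variable {X k : ℕ} {s : Store} {Q : Store → Prop}

/-- The value of an expression. -/
def Expr.val (e : Expr) (s : Store) : ℕ := e.eval s.mem

theorem Store.mem_entry (s : Store) {a : ℕ} (ha : a < 8) (e : ℕ) :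
    s.mem (8 * e + a) = s.array a e := by
  unfold Store.mem
  congr 1
  · omega
  · omega

@[simp] theorem val_lit (c : ℕ) : (Expr.lit c).val s = c := rfl
@[simp] theorem val_add (a b : Expr) : (Expr.add a b).val s = a.val s + b.val s := rfl
@[simp] theorem val_sub (a b : Expr) : (Expr.sub a b).val s = a.val s - b.val s := rfl
@[simp] theorem val_mul (a b : Expr) : (Expr.mul a b).val s = a.val s * b.val s := rfl

theorem val_cell_entry {a : ℕ} (ha : a < 8) (e : Expr) :
    (Expr.cell (entry a e)).val s = s.array a (e.val s) :=
  s.mem_entry ha _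

@[simp] theorem val_seq (e : Expr) : (Expr.cell (entry 1 e)).val s = s.seq (e.val s) :=
  val_cell_entry (by norm_num) e
@[simp] theorem val_pref (e : Expr) : (Expr.cell (entry 2 e)).val s = s.pref (e.val s) :=
  val_cell_entry (by norm_num) e
@[simp] theorem val_pos (e : Expr) : (Expr.cell (entry 3 e)).val s = s.pos (e.val s) :=
  val_cell_entry (by norm_num) e
@[simp] theorem val_len (e : Expr) : (Expr.cell (entry 4 e)).val s = s.len (e.val s) :=
  val_cell_entry (by norm_num) e
@[simp] theorem val_cst (e : Expr) : (Expr.cell (entry 5 e)).val s = s.cst (e.val s) :=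
  val_cell_entry (by norm_num) e

theorem val_var (q : ℕ) : (var q).val s = s.scalar q :=
  s.mem_entry (a := 0) (by norm_num) q

@[simp] theorem val_m : (var 0).val s = s.m := val_var 0
@[simp] theorem val_n : (var 1).val s = s.n := val_var 1
@[simp] theorem val_r : (var 2).val s = s.r := val_var 2
@[simp] theorem val_i : (var 3).val s = s.i := val_var 3
@[simp] theorem val_j : (var 4).val s = s.j := val_var 4
@[simp] theorem val_k : (var 5).val s = s.k := val_var 5
@[simp] theorem val_bud : (var 6).val s = s.bud := val_var 6
@[simp] theorem val_go : (var 7).val s = s.go := val_var 7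
@[simp] theorem val_head : (var 8).val s = s.head := val_var 8
@[simp] theorem val_tail : (var 9).val s = s.tail := val_var 9
@[simp] theorem val_win : (var 10).val s = s.win := val_var 10
@[simp] theorem val_acc : (var 11).val s = s.acc := val_var 11

theorem Store.Bounded.size_le (h : s.Bounded X) (a : ℕ) : Nat.size (s.mem a) ≤ Nat.size X + 1 :=
  (Nat.size_le_size (h.1 a)).trans (Nat.le_succ _)

theorem Store.Bounded.size_val_le (h : s.Bounded X) (e : Expr) :
    Nat.size (e.val s) ≤ e.width * (Nat.size X + 1) :=
  e.size_eval_le (by omega) h.size_le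

theorem Store.Bounded.cost_le (h : s.Bounded X) (e : Expr) :
    e.cost s.mem ≤ e.weight * (Nat.size X + 1) :=
  e.cost_le (by omega) h.size_le

/-- The number `10000` exceeds `weight + width` for every expression in the fixed program, so one
constant serves all operations; `decide` verifies each instance. Addresses need no bound by `X`,
since `width` already accounts for them. -/
theorem Store.Bounded.opCost_le (h : s.Bounded X) {e : Expr} (he : e.weight + e.width < 10000) :
    e.cost s.mem + (1 + Nat.size (e.val s)) ≤ opCost X := by
  have h1 := h.cost_le e
  have h2 := h.size_val_le e
  have h3 : (e.weight + e.width + 1) * (Nat.size X + 1) ≤ opCost X := Nat.mul_le_mul_right _ he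
  rw [add_mul, add_mul] at h3
  omega

theorem Reaches.mono {p : Program} {Q' : Store → Prop} {k k' : ℕ} (h : Reaches X p s k Q)
    (hk : k ≤ k') (hQ : ∀ s', Q s' → Q' s') : Reaches X p s k' Q' := by
  intro hs
  obtain ⟨s', t, h1, h2, h3, h4⟩ := h hs
  exact ⟨s', t, h1, h2.trans (Nat.mul_le_mul_right _ hk), h3, hQ _ h4⟩

theorem Reaches.weaken {p : Program} {k k' : ℕ} (h : Reaches X p s k Q) (hk : k ≤ k') :
    Reaches X p s k' Q := h.mono hk fun _ h => h

theorem Reaches.imp {p : Program} {Q' : Store → Prop} {k : ℕ} (h : Reaches X p s k Q)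
    (hQ : ∀ s', Q s' → Q' s') : Reaches X p s k Q' := h.mono le_rfl hQ

/-- The bound on the numbers may be used to establish a triple. -/
theorem Reaches.of_bounded {p : Program} {k : ℕ} (h : s.Bounded X → Reaches X p s k Q) :
    Reaches X p s k Q := fun hs => h hs hs

theorem reaches_skip (hQ : Q s) : Reaches X .skip s (k + 1) Q := by
  intro hs
  refine ⟨s, 1, Exec.skip _, (?_ : 1 ≤ 1 * opCost X).trans ?_, hs, hQ⟩
  · unfold opCost
    omega
  · exact Nat.mul_le_mul_right _ (by omega)

theorem reaches_seq {p q : Program} {k₁ k₂ : ℕ}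
    (h : Reaches X p s k₁ fun s' => Reaches X q s' k₂ Q) : Reaches X (.seq p q) s (k₁ + k₂) Q := by
  intro hs
  obtain ⟨s₁, t₁, h1, h2, h3, h4⟩ := h hs
  obtain ⟨s₂, t₂, h5, h6, h7, h8⟩ := h4 h3
  exact ⟨s₂, t₁ + t₂, h1.seq h5, by rw [add_mul]; omega, h7, h8⟩

theorem reaches_ite {e : Expr} {p q : Program}
    (h₁ : e.val s ≠ 0 → Reaches X p s k Q) (h₂ : e.val s = 0 → Reaches X q s k Q)
    (he : e.weight + e.width < 10000 := by decide) :
    Reaches X (.ite e p q) s (k + 1) Q := by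
  intro hs
  have hc := hs.opCost_le he
  by_cases h : e.val s = 0
  · obtain ⟨s', t, h1, h2, h3, h4⟩ := h₂ h hs
    exact ⟨s', _, Exec.ite_false h h1, by rw [add_mul]; simp only [Store.state]; omega, h3, h4⟩
  · obtain ⟨s', t, h1, h2, h3, h4⟩ := h₁ h hs
    refine ⟨s', _, Exec.ite_true h h1, ?_, h3, h4⟩
    rw [add_mul]
    simp only [Expr.val] at hc
    simp only [Store.state]
    omega

/-- Loop rule: `I c` holds after `c` iterations, and there are `n` of them. -/
theorem reaches_loop {e : Expr} {p : Program} {k : ℕ} (n : ℕ) (I : ℕ → Store → Prop) (h₀ : I 0 s)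
    (hn : ∀ s', I n s' → e.val s' = 0)
    (hI : ∀ c < n, ∀ s', I c s' → e.val s' ≠ 0 ∧ Reaches X p s' k (I (c + 1)))
    (he : e.weight + e.width < 10000 := by decide) :
    Reaches X (.loop e p) s (n * (k + 1) + 1) (I n) := by
  -- Induction on the number `c` of iterations that are still to come.
  suffices H : ∀ c ≤ n, ∀ s', I (n - c) s' → Reaches X (.loop e p) s' (c * (k + 1) + 1) (I n) from
    H n le_rfl s (by simpa using h₀)
  intro c
  induction c with
  | zero =>
    intro _ s' hs' hb
    have hc := hb.opCost_le he
    refine ⟨s', _, Exec.loop_false (hn s' hs'), ?_, hb, hs'⟩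
    simp only [Store.state]
    omega
  | succ c ih =>
    intro hc' s' hs' hb
    have hc := hb.opCost_le he
    obtain ⟨h1, h2⟩ := hI (n - (c + 1)) (by omega) s' hs'
    obtain ⟨s₁, t₁, h3, h4, h5, h6⟩ := h2 hb
    rw [show n - (c + 1) + 1 = n - c by omega] at h6
    obtain ⟨s₂, t₂, h7, h8, h9, h10⟩ := ih (by omega) s₁ h6 h5
    refine ⟨s₂, _, Exec.loop_true h1 h3 h7, ?_, h9, h10⟩
    simp only [add_mul, one_mul] at h8 ⊢
    simp only [Expr.val] at hc
    simp only [Store.state]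
    omega

theorem reaches_write {e : Expr} (hQ : Q { s with out := s.out ++ [e.val s] })
    (he : e.weight + e.width < 10000 := by decide) : Reaches X (.write e) s (k + 1) Q := by
  suffices H : Reaches X (.write e) s 1 Q from H.weaken (by omega)
  intro hs
  refine ⟨_, _, Exec.write _ _, ?_, ?_, hQ⟩
  · rw [one_mul]; exact hs.opCost_le he
  · exact hs

theorem Store.Bounded.of_update {s' : Store} (hs : s.Bounded X) {a v : ℕ}
    (h : s'.mem = Function.update s.mem a v) (hv : v ≤ X) (hi : ∀ x ∈ s'.inp, x ∈ s.inp) :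
    s'.Bounded X := by
  refine ⟨fun b => ?_, fun x hx => hs.2 x (hi x hx)⟩
  rw [h, Function.update_apply]
  split_ifs
  · exact hv
  · exact hs.1 b

theorem reaches_assign {a e : Expr} {s' : Store}
    (h : s'.mem = Function.update s.mem (a.val s) (e.val s)) (hi : s'.inp = s.inp)
    (ho : s'.out = s.out) (hX : e.val s ≤ X) (hQ : Q s')
    (he : a.weight + a.width + (e.weight + e.width) < 10000) : Reaches X (.assign a e) s (k + 1) Q := by
  suffices H : Reaches X (.assign a e) s 1 Q from H.weaken (by omega)
  intro hs
  have hx : s'.state = { s.state with mem := Function.update s.mem (a.val s) (e.val s) } := by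
    simp only [Store.state, h, hi, ho]
  refine ⟨s', _, hx ▸ Exec.assign a e s.state, ?_, hs.of_update h hX (by simp [hi]), hQ⟩
  have h1 := hs.cost_le a
  have h2 := hs.size_val_le a
  have h3 := hs.cost_le e
  have h4 := hs.size_val_le e
  have h5 : (a.weight + a.width + (e.weight + e.width) + 1) * (Nat.size X + 1) ≤ opCost X :=
    Nat.mul_le_mul_right _ he
  simp only [add_mul, Expr.val] at h1 h2 h3 h4 h5
  simp only [Store.state]
  omega

theorem reaches_read {a : Expr} {s' : Store} {x : ℕ} {l : List ℕ} (hl : s.inp = x :: l)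
    (h : s'.mem = Function.update s.mem (a.val s) x) (hi : s'.inp = l)
    (ho : s'.out = s.out) (hQ : Q s')
    (he : a.weight + a.width < 9999) : Reaches X (.read a) s (k + 1) Q := by
  suffices H : Reaches X (.read a) s 1 Q from H.weaken (by omega)
  intro hs
  have hx : s'.state = { s.state with
      mem := Function.update s.mem (a.val s) (s.state.inp.headD 0), inp := s.state.inp.tail } := by
    simp only [Store.state, h, hi, ho, hl, List.headD_cons, List.tail_cons]
  have hX : x ≤ X := hs.2 x (by simp [hl])
  refine ⟨s', _, hx ▸ Exec.read a s.state, ?_, hs.of_update h hX (by simp [hi, hl]; tauto), hQ⟩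
  have h1 := hs.cost_le a
  have h2 := hs.size_val_le a
  have h3 := Nat.size_le_size hX
  have h5 : (a.weight + a.width + 2) * (Nat.size X + 1) ≤ opCost X :=
    Nat.mul_le_mul_right _ (by omega)
  simp only [add_mul, Expr.val] at h1 h2 h5
  simp only [Store.state, hl, List.headD_cons]
  omega

/-- The residue modulo `8` of an address determines its array, so a write to one array cannot touch
another one. -/
theorem Store.mem_eq_update {s' : Store} {a e v : ℕ} (ha : a < 8)
    (h : s'.array a = Function.update (s.array a) e v)
    (h' : ∀ b < 8, b ≠ a → s'.array b = s.array b) :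
    s'.mem = Function.update s.mem (8 * e + a) v := by
  funext x
  simp only [Store.mem, Function.update_apply]
  by_cases hx : x % 8 = a
  · rw [hx, h, Function.update_apply]
    have : x / 8 = e ↔ x = 8 * e + a := by omega
    simp only [this]
  · rw [h' _ (Nat.mod_lt _ (by norm_num)) hx, if_neg (by omega)]

theorem Store.mem_eq_update_scalar {s' : Store} {q v : ℕ}
    (h : ∀ b, s'.scalar b = if b = q then v else s.scalar b)
    (h' : ∀ b < 8, b ≠ 0 → s'.array b = s.array b) :
    s'.mem = Function.update s.mem (8 * q) v :=
  Store.mem_eq_update (a := 0) (by norm_num)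
    (by funext b; rw [Function.update_apply]; exact h b) h'

/-! ### Proof rules for blocks, assignments and input. -/

/-- Assignment to the scalar variable number `q`. -/
def setv (q : ℕ) (e : Expr) : Program := .assign (.lit (8 * q)) e

/-- Assignment to the entry `x` of the array number `a`. -/
def store (a : ℕ) (x e : Expr) : Program := .assign (entry a x) e

/-- Sequential composition of a list of programs. -/
def block : List Program → Program
  | [] => .skip
  | p :: ps => .seq p (block ps)

theorem reaches_nil (hQ : Q s) : Reaches X (block []) s (k + 1) Q := reaches_skip hQ

/-- The first program of a block is elementary. -/
theorem reaches_cons {p : Program} {ps : List Program}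
    (h : Reaches X p s 1 fun s' => Reaches X (block ps) s' k Q) :
    Reaches X (block (p :: ps)) s (k + 1) Q :=
  (reaches_seq h).weaken (by omega)

theorem reaches_block {p : Program} {ps : List Program} {k₁ k₂ : ℕ}
    (h : Reaches X p s k₁ fun s' => Reaches X (block ps) s' k₂ Q) (hk : k₁ + k₂ ≤ k) :
    Reaches X (block (p :: ps)) s k Q :=
  (reaches_seq h).weaken hk

theorem reaches_setv {q : ℕ} {e : Expr} {s' : Store}
    (h : ∀ b, s'.scalar b = if b = q then e.val s else s.scalar b)
    (h' : ∀ b < 8, b ≠ 0 → s'.array b = s.array b) (hi : s'.inp = s.inp)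
    (ho : s'.out = s.out) (hX : e.val s ≤ X) (hQ : Q s')
    (he : 1 + 8 * q + 8 * q + (e.weight + e.width) < 10000) : Reaches X (setv q e) s (k + 1) Q :=
  reaches_assign (Store.mem_eq_update_scalar h h') hi ho hX hQ he

theorem reaches_store {a : ℕ} {x e : Expr} {s' : Store} (ha : a < 8)
    (h : s'.array a = Function.update (s.array a) (x.val s) (e.val s))
    (h' : ∀ b < 8, b ≠ a → s'.array b = s.array b) (hi : s'.inp = s.inp)
    (ho : s'.out = s.out) (hX : e.val s ≤ X) (hQ : Q s')
    (he : (entry a x).weight + (entry a x).width + (e.weight + e.width) < 10000) :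
    Reaches X (store a x e) s (k + 1) Q :=
  reaches_assign (Store.mem_eq_update ha h h') hi ho hX hQ he

section Variables

variable {e x : Expr}

/-- In this rule and its analogues the new state is an update of one record field, so that
correctness proofs of programs need not mention addresses. -/
theorem reaches_set_n (hX : e.val s ≤ X) (hQ : Q { s with n := e.val s })
    (he : 1 + 8 * 1 + 8 * 1 + (e.weight + e.width) < 10000 := by decide) :
    Reaches X (setv 1 e) s (k + 1) Q :=
  reaches_setv (s' := { s with n := e.val s })
    (by rintro (_ | _ | _ | _ | _ | _ | _ | _ | _ | _ | _ | _ | b) <;> simp [Store.scalar])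
    (by intro b hb hb'; interval_cases b <;> first | rfl | exact absurd rfl hb') rfl rfl hX hQ he

theorem reaches_set_r (hX : e.val s ≤ X) (hQ : Q { s with r := e.val s })
    (he : 1 + 8 * 2 + 8 * 2 + (e.weight + e.width) < 10000 := by decide) :
    Reaches X (setv 2 e) s (k + 1) Q :=
  reaches_setv (s' := { s with r := e.val s })
    (by rintro (_ | _ | _ | _ | _ | _ | _ | _ | _ | _ | _ | _ | b) <;> simp [Store.scalar])
    (by intro b hb hb'; interval_cases b <;> first | rfl | exact absurd rfl hb') rfl rfl hX hQ he

theorem reaches_set_i (hX : e.val s ≤ X) (hQ : Q { s with i := e.val s })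
    (he : 1 + 8 * 3 + 8 * 3 + (e.weight + e.width) < 10000 := by decide) :
    Reaches X (setv 3 e) s (k + 1) Q :=
  reaches_setv (s' := { s with i := e.val s })
    (by rintro (_ | _ | _ | _ | _ | _ | _ | _ | _ | _ | _ | _ | b) <;> simp [Store.scalar])
    (by intro b hb hb'; interval_cases b <;> first | rfl | exact absurd rfl hb') rfl rfl hX hQ he

theorem reaches_set_j (hX : e.val s ≤ X) (hQ : Q { s with j := e.val s })
    (he : 1 + 8 * 4 + 8 * 4 + (e.weight + e.width) < 10000 := by decide) :
    Reaches X (setv 4 e) s (k + 1) Q :=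
  reaches_setv (s' := { s with j := e.val s })
    (by rintro (_ | _ | _ | _ | _ | _ | _ | _ | _ | _ | _ | _ | b) <;> simp [Store.scalar])
    (by intro b hb hb'; interval_cases b <;> first | rfl | exact absurd rfl hb') rfl rfl hX hQ he

theorem reaches_set_k (hX : e.val s ≤ X) (hQ : Q { s with k := e.val s })
    (he : 1 + 8 * 5 + 8 * 5 + (e.weight + e.width) < 10000 := by decide) :
    Reaches X (setv 5 e) s (k + 1) Q :=
  reaches_setv (s' := { s with k := e.val s })
    (by rintro (_ | _ | _ | _ | _ | _ | _ | _ | _ | _ | _ | _ | b) <;> simp [Store.scalar])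
    (by intro b hb hb'; interval_cases b <;> first | rfl | exact absurd rfl hb') rfl rfl hX hQ he

theorem reaches_set_bud (hX : e.val s ≤ X) (hQ : Q { s with bud := e.val s })
    (he : 1 + 8 * 6 + 8 * 6 + (e.weight + e.width) < 10000 := by decide) :
    Reaches X (setv 6 e) s (k + 1) Q :=
  reaches_setv (s' := { s with bud := e.val s })
    (by rintro (_ | _ | _ | _ | _ | _ | _ | _ | _ | _ | _ | _ | b) <;> simp [Store.scalar])
    (by intro b hb hb'; interval_cases b <;> first | rfl | exact absurd rfl hb') rfl rfl hX hQ he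

theorem reaches_set_go (hX : e.val s ≤ X) (hQ : Q { s with go := e.val s })
    (he : 1 + 8 * 7 + 8 * 7 + (e.weight + e.width) < 10000 := by decide) :
    Reaches X (setv 7 e) s (k + 1) Q :=
  reaches_setv (s' := { s with go := e.val s })
    (by rintro (_ | _ | _ | _ | _ | _ | _ | _ | _ | _ | _ | _ | b) <;> simp [Store.scalar])
    (by intro b hb hb'; interval_cases b <;> first | rfl | exact absurd rfl hb') rfl rfl hX hQ he

theorem reaches_set_head (hX : e.val s ≤ X) (hQ : Q { s with head := e.val s })
    (he : 1 + 8 * 8 + 8 * 8 + (e.weight + e.width) < 10000 := by decide) :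
    Reaches X (setv 8 e) s (k + 1) Q :=
  reaches_setv (s' := { s with head := e.val s })
    (by rintro (_ | _ | _ | _ | _ | _ | _ | _ | _ | _ | _ | _ | b) <;> simp [Store.scalar])
    (by intro b hb hb'; interval_cases b <;> first | rfl | exact absurd rfl hb') rfl rfl hX hQ he

theorem reaches_set_tail (hX : e.val s ≤ X) (hQ : Q { s with tail := e.val s })
    (he : 1 + 8 * 9 + 8 * 9 + (e.weight + e.width) < 10000 := by decide) :
    Reaches X (setv 9 e) s (k + 1) Q :=
  reaches_setv (s' := { s with tail := e.val s })
    (by rintro (_ | _ | _ | _ | _ | _ | _ | _ | _ | _ | _ | _ | b) <;> simp [Store.scalar])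
    (by intro b hb hb'; interval_cases b <;> first | rfl | exact absurd rfl hb') rfl rfl hX hQ he

theorem reaches_set_win (hX : e.val s ≤ X) (hQ : Q { s with win := e.val s })
    (he : 1 + 8 * 10 + 8 * 10 + (e.weight + e.width) < 10000 := by decide) :
    Reaches X (setv 10 e) s (k + 1) Q :=
  reaches_setv (s' := { s with win := e.val s })
    (by rintro (_ | _ | _ | _ | _ | _ | _ | _ | _ | _ | _ | _ | b) <;> simp [Store.scalar])
    (by intro b hb hb'; interval_cases b <;> first | rfl | exact absurd rfl hb') rfl rfl hX hQ he

theorem reaches_set_acc (hX : e.val s ≤ X) (hQ : Q { s with acc := e.val s })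
    (he : 1 + 8 * 11 + 8 * 11 + (e.weight + e.width) < 10000 := by decide) :
    Reaches X (setv 11 e) s (k + 1) Q :=
  reaches_setv (s' := { s with acc := e.val s })
    (by rintro (_ | _ | _ | _ | _ | _ | _ | _ | _ | _ | _ | _ | b) <;> simp [Store.scalar])
    (by intro b hb hb'; interval_cases b <;> first | rfl | exact absurd rfl hb') rfl rfl hX hQ he

theorem reaches_store_pref (hX : e.val s ≤ X)
    (hQ : Q { s with pref := Function.update s.pref (x.val s) (e.val s) })
    (he : (entry 2 x).weight + (entry 2 x).width + (e.weight + e.width) < 10000 := by decide) :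
    Reaches X (store 2 x e) s (k + 1) Q :=
  reaches_store (s' := { s with pref := Function.update s.pref (x.val s) (e.val s) })
    (by norm_num) rfl
    (by intro b hb hb'; interval_cases b <;> first | rfl | exact absurd rfl hb') rfl rfl hX hQ he

theorem reaches_store_pos (hX : e.val s ≤ X)
    (hQ : Q { s with pos := Function.update s.pos (x.val s) (e.val s) })
    (he : (entry 3 x).weight + (entry 3 x).width + (e.weight + e.width) < 10000 := by decide) :
    Reaches X (store 3 x e) s (k + 1) Q :=
  reaches_store (s' := { s with pos := Function.update s.pos (x.val s) (e.val s) })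
    (by norm_num) rfl
    (by intro b hb hb'; interval_cases b <;> first | rfl | exact absurd rfl hb') rfl rfl hX hQ he

theorem reaches_store_len (hX : e.val s ≤ X)
    (hQ : Q { s with len := Function.update s.len (x.val s) (e.val s) })
    (he : (entry 4 x).weight + (entry 4 x).width + (e.weight + e.width) < 10000 := by decide) :
    Reaches X (store 4 x e) s (k + 1) Q :=
  reaches_store (s' := { s with len := Function.update s.len (x.val s) (e.val s) })
    (by norm_num) rfl
    (by intro b hb hb'; interval_cases b <;> first | rfl | exact absurd rfl hb') rfl rfl hX hQ he

theorem reaches_store_cst (hX : e.val s ≤ X)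
    (hQ : Q { s with cst := Function.update s.cst (x.val s) (e.val s) })
    (he : (entry 5 x).weight + (entry 5 x).width + (e.weight + e.width) < 10000 := by decide) :
    Reaches X (store 5 x e) s (k + 1) Q :=
  reaches_store (s' := { s with cst := Function.update s.cst (x.val s) (e.val s) })
    (by norm_num) rfl
    (by intro b hb hb'; interval_cases b <;> first | rfl | exact absurd rfl hb') rfl rfl hX hQ he

end Variables

theorem reaches_read_m {x : ℕ} {l : List ℕ} (hl : s.inp = x :: l)
    (hQ : Q { s with m := x, inp := l }) : Reaches X (.read (.lit (8 * 0))) s (k + 1) Q :=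
  reaches_read (s' := { s with m := x, inp := l })
    hl (Store.mem_eq_update_scalar (s := s)
    (by rintro (_ | _ | _ | _ | _ | _ | _ | _ | _ | _ | _ | _ | b) <;> simp [Store.scalar])
    (by intro b hb hb'; interval_cases b <;> first | rfl | exact absurd rfl hb'))
    rfl rfl hQ (by decide)

theorem reaches_read_n {x : ℕ} {l : List ℕ} (hl : s.inp = x :: l)
    (hQ : Q { s with n := x, inp := l }) : Reaches X (.read (.lit (8 * 1))) s (k + 1) Q :=
  reaches_read (s' := { s with n := x, inp := l })
    hl (Store.mem_eq_update_scalar (s := s)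
    (by rintro (_ | _ | _ | _ | _ | _ | _ | _ | _ | _ | _ | _ | b) <;> simp [Store.scalar])
    (by intro b hb hb'; interval_cases b <;> first | rfl | exact absurd rfl hb'))
    rfl rfl hQ (by decide)

theorem reaches_read_r {x : ℕ} {l : List ℕ} (hl : s.inp = x :: l)
    (hQ : Q { s with r := x, inp := l }) : Reaches X (.read (.lit (8 * 2))) s (k + 1) Q :=
  reaches_read (s' := { s with r := x, inp := l })
    hl (Store.mem_eq_update_scalar (s := s)
    (by rintro (_ | _ | _ | _ | _ | _ | _ | _ | _ | _ | _ | _ | b) <;> simp [Store.scalar])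
    (by intro b hb hb'; interval_cases b <;> first | rfl | exact absurd rfl hb'))
    rfl rfl hQ (by decide)

theorem reaches_read_seq {x : ℕ} {l : List ℕ} {a : Expr} (hl : s.inp = x :: l)
    (hQ : Q { s with seq := Function.update s.seq (a.val s) x, inp := l })
    (ha : (entry 1 a).weight + (entry 1 a).width < 9999 := by decide) :
    Reaches X (.read (entry 1 a)) s (k + 1) Q :=
  reaches_read (s' := { s with seq := Function.update s.seq (a.val s) x, inp := l })
    hl (Store.mem_eq_update (s := s) (a := 1) (by norm_num) rfl
    (by intro b hb hb'; interval_cases b <;> first | rfl | exact absurd rfl hb')) rfl rfl hQ ha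

end RAM

namespace Kemeny

open Finset

/-! ## The search tree -/

/-- Cost of choosing `c` when the candidates in `P` have been chosen already: the number of
disagreements of the votes with the ranking of `c` before all the remaining candidates, where
`N b c` is the number of votes that prefer `b` to `c`. -/
def stepCost (m : ℕ) (N : ℕ → ℕ → ℕ) (P : List ℕ) (c : ℕ) : ℕ :=
  ∑ b ∈ range m, if b ∈ P then 0 else N b c

/-- Cost of the initial part of a ranking; `P` lists its candidates, the last chosen one first. -/
def prefixCost (m : ℕ) (N : ℕ → ℕ → ℕ) : List ℕ → ℕ
  | [] => 0
  | c :: P => prefixCost m N P + stepCost m N P c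

/-- `e` is the Condorcet winner of the candidates that are not in `P`. -/
def IsWinner (m : ℕ) (N : ℕ → ℕ → ℕ) (P : List ℕ) (e : ℕ) : Prop :=
  e ∉ P ∧ ∀ b < m, b ∉ P → b ≠ e → N b e < N e b

instance (m : ℕ) (N : ℕ → ℕ → ℕ) (P : List ℕ) (e : ℕ) : Decidable (IsWinner m N P e) :=
  inferInstanceAs (Decidable (_ ∧ _))

/-- The search continues from `P` with `c` if there is no other Condorcet winner and the cost
stays within the budget. -/
def Admissible (m : ℕ) (N : ℕ → ℕ → ℕ) (B : ℕ) (P : List ℕ) (c : ℕ) : Prop :=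
  c ∉ P ∧ (∀ e < m, IsWinner m N P e → e = c) ∧ prefixCost m N P + stepCost m N P c ≤ B

instance (m : ℕ) (N : ℕ → ℕ → ℕ) (B : ℕ) (P : List ℕ) (c : ℕ) :
    Decidable (Admissible m N B P c) :=
  inferInstanceAs (Decidable (_ ∧ _ ∧ _))

/-- The first `k` candidates that are admissible after `P`, each put in front of `P`. -/
def childrenUpTo (m : ℕ) (N : ℕ → ℕ → ℕ) (B : ℕ) (P : List ℕ) (k : ℕ) : List (List ℕ) :=
  ((List.range k).filter fun c => Admissible m N B P c).map (· :: P)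

/-- The children of `P` in the search tree. -/
abbrev children (m : ℕ) (N : ℕ → ℕ → ℕ) (B : ℕ) (P : List ℕ) : List (List ℕ) :=
  childrenUpTo m N B P m

/-- The children of `P` that arise from the candidate `c`. -/
def childFor (m : ℕ) (N : ℕ → ℕ → ℕ) (B : ℕ) (P : List ℕ) (c : ℕ) : List (List ℕ) :=
  if Admissible m N B P c then [c :: P] else []

/-- Number of nodes of the search tree below `P`, down to relative depth `k`. -/
def treeSize (m : ℕ) (N : ℕ → ℕ → ℕ) (B : ℕ) : ℕ → List ℕ → ℕ
  | 0, _ => 1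
  | k + 1, P => 1 + ((children m N B P).map (treeSize m N B k)).sum

/-- The nodes of the search tree below `P` at relative depth `k`. -/
def leaves (m : ℕ) (N : ℕ → ℕ → ℕ) (B : ℕ) : ℕ → List ℕ → List (List ℕ)
  | 0, P => [P]
  | k + 1, P => (children m N B P).flatMap (leaves m N B k)

/-- `P` is a node of the search tree. -/
def IsNode (m : ℕ) (N : ℕ → ℕ → ℕ) (B : ℕ) : List ℕ → Prop
  | [] => True
  | c :: P => c < m ∧ Admissible m N B P c ∧ IsNode m N B P

/-- Position (counted from `1`) at which `b` was chosen, `0` if it is not in `P`. -/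
def placeIn : List ℕ → ℕ → ℕ
  | [], _ => 0
  | c :: P, b => if b = c then P.length + 1 else placeIn P b

variable {m : ℕ} {N : ℕ → ℕ → ℕ} {B : ℕ}

theorem mem_childrenUpTo {P P' : List ℕ} {k : ℕ} :
    P' ∈ childrenUpTo m N B P k ↔ ∃ c < k, Admissible m N B P c ∧ P' = c :: P := by
  simp only [childrenUpTo, List.mem_map, List.mem_filter, List.mem_range, decide_eq_true_eq]
  constructor
  · rintro ⟨c, ⟨h1, h2⟩, rfl⟩; exact ⟨c, h1, h2, rfl⟩
  · rintro ⟨c, h1, h2, rfl⟩; exact ⟨c, ⟨h1, h2⟩, rfl⟩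

theorem childrenUpTo_succ (P : List ℕ) (k : ℕ) :
    childrenUpTo m N B P (k + 1) =
      childrenUpTo m N B P k ++ childFor m N B P k := by
  unfold childrenUpTo childFor
  rw [List.range_succ, List.filter_append, List.map_append]
  congr 1
  by_cases h : Admissible m N B P k <;> simp [h]

theorem treeSize_pos (k : ℕ) (P : List ℕ) : 1 ≤ treeSize m N B k P := by
  cases k <;> simp [treeSize]

theorem IsNode.nodup {P : List ℕ} (h : IsNode m N B P) : P.Nodup := by
  induction P with
  | nil => exact List.nodup_nil
  | cons c P ih => exact List.nodup_cons.2 ⟨h.2.1.1, ih h.2.2⟩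

theorem IsNode.lt {P : List ℕ} (h : IsNode m N B P) : ∀ c ∈ P, c < m := by
  induction P with
  | nil => simp
  | cons c P ih =>
    intro b hb
    rcases List.mem_cons.1 hb with rfl | hb
    · exact h.1
    · exact ih h.2.2 b hb

theorem IsNode.length_le {P : List ℕ} (h : IsNode m N B P) : P.length ≤ m := by
  simpa using (h.nodup.subperm (l₂ := List.range m) fun c hc =>
    List.mem_range.2 (h.lt c hc)).length_le

theorem IsNode.prefixCost_le {P : List ℕ} (h : IsNode m N B P) : prefixCost m N P ≤ B := by
  cases P with
  | nil => simp [prefixCost]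
  | cons c P => exact h.2.1.2.2

theorem IsNode.of_mem_children {P P' : List ℕ} (h : IsNode m N B P)
    (h' : P' ∈ children m N B P) : IsNode m N B P' := by
  obtain ⟨c, hc, ha, rfl⟩ := mem_childrenUpTo.1 h'
  exact ⟨hc, ha, h⟩

theorem IsNode.of_append {l P : List ℕ} (h : IsNode m N B (l ++ P)) : IsNode m N B P := by
  induction l with
  | nil => exact h
  | cons a l ih => exact ih h.2.2

/-- New choices are put at the front, so the descendants of `P` are the nodes that have `P` as a
suffix. -/
theorem mem_leaves {k : ℕ} {P P' : List ℕ} (h : IsNode m N B P) :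
    P' ∈ leaves m N B k P ↔ IsNode m N B P' ∧ P <:+ P' ∧ P'.length = k + P.length := by
  induction k generalizing P with
  | zero =>
    simp only [leaves, List.mem_singleton, zero_add]
    constructor
    · rintro rfl; exact ⟨h, List.suffix_rfl, rfl⟩
    · rintro ⟨_, h2, h3⟩; exact (h2.eq_of_length h3.symm).symm
  | succ k ih =>
    simp only [leaves, List.mem_flatMap]
    constructor
    · rintro ⟨P₁, h1, h2⟩
      obtain ⟨h3, h4, h5⟩ := (ih (h.of_mem_children h1)).1 h2
      obtain ⟨c, _, _, rfl⟩ := mem_childrenUpTo.1 h1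
      refine ⟨h3, (List.suffix_cons c P).trans h4, ?_⟩
      rw [h5, List.length_cons]; ring
    · rintro ⟨h1, ⟨l, rfl⟩, h3⟩
      rw [List.length_append] at h3
      obtain ⟨l', c, rfl⟩ : ∃ l' c, l = l' ++ [c] := by
        rcases List.eq_nil_or_concat l with rfl | ⟨l', c, hl⟩
        · simp at h3
        · exact ⟨l', c, by simpa using hl⟩
      have h4 : IsNode m N B (c :: P) := by
        rw [List.append_assoc] at h1
        exact h1.of_append
      have h5 : c :: P ∈ children m N B P := mem_childrenUpTo.2 ⟨c, h4.1, h4.2.1, rfl⟩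
      refine ⟨c :: P, h5, (ih h4).2 ⟨h1, ⟨l', by simp⟩, ?_⟩⟩
      simp at h3 ⊢; omega

/-- A common leaf of two subtrees would have both children as suffixes of the same length, which
makes them equal. Hence no ranking is written twice. -/
theorem leaves_nodup {k : ℕ} {P : List ℕ} (h : IsNode m N B P) : (leaves m N B k P).Nodup := by
  induction k generalizing P with
  | zero => simp [leaves]
  | succ k ih =>
    rw [leaves, List.nodup_flatMap]
    refine ⟨fun P' h' => ih (h.of_mem_children h'), ?_⟩
    have hnd : (children m N B P).Nodup :=
      (List.nodup_range.filter _).map fun a b hab => (List.cons.inj hab).1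
    refine hnd.pairwise_of_forall_ne fun P₁ h₁ P₂ h₂ hne => ?_
    intro Q hQ₁ hQ₂
    have e₁ := ((mem_leaves (h.of_mem_children h₁)).1 hQ₁).2.1
    have e₂ := ((mem_leaves (h.of_mem_children h₂)).1 hQ₂).2.1
    obtain ⟨c₁, _, _, rfl⟩ := mem_childrenUpTo.1 h₁
    obtain ⟨c₂, _, _, rfl⟩ := mem_childrenUpTo.1 h₂
    exact hne ((List.suffix_of_suffix_length_le e₁ e₂ (by simp)).eq_of_length (by simp))

theorem placeIn_eq_zero {P : List ℕ} {b : ℕ} : placeIn P b = 0 ↔ b ∉ P := by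
  induction P with
  | nil => simp [placeIn]
  | cons c P ih =>
    by_cases h : b = c
    · simp [placeIn, h]
    · simp [placeIn, h, ih]

theorem placeIn_le (P : List ℕ) (b : ℕ) : placeIn P b ≤ P.length := by
  induction P with
  | nil => simp [placeIn]
  | cons c P ih =>
    simp only [placeIn, List.length_cons]
    split_ifs <;> omega

/-- The candidate chosen at position `t + 1` is the entry `t` of the reversed list. -/
theorem placeIn_eq_succ {P : List ℕ} (hP : P.Nodup) {t : ℕ} (ht : t < P.length) {b : ℕ} :
    placeIn P b = t + 1 ↔ P.reverse[t]'(by simpa using ht) = b := by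
  induction P with
  | nil => simp at ht
  | cons c P ih =>
    rw [List.nodup_cons] at hP
    simp only [placeIn, List.reverse_cons]
    rw [List.length_cons] at ht
    rcases Nat.lt_succ_iff_lt_or_eq.1 ht with h | h
    · rw [List.getElem_append_left (by simpa using h), ← ih hP.2 h]
      by_cases hb : b = c
      · have := placeIn_eq_zero.2 hP.1
        subst hb
        simp only [if_true]
        omega
      · simp [hb]
    · subst h
      have := placeIn_le P b
      simp only [List.length_reverse, le_refl, List.getElem_append_right, Nat.sub_self,
        List.getElem_cons_zero]
      by_cases hb : b = c
      · simp [hb]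
      · simp only [hb, if_false, eq_comm (a := c)]
        constructor
        · omega
        · simp

/-! ### The exchange argument for Condorcet winners. -/

theorem stepCost_congr {P P' : List ℕ} (h : ∀ b, b ∈ P ↔ b ∈ P') (c : ℕ) :
    stepCost m N P c = stepCost m N P' c := by
  unfold stepCost
  simp [h]

theorem stepCost_cons {P : List ℕ} {b : ℕ} (hb : b < m) (hP : b ∉ P) (c : ℕ) :
    stepCost m N (b :: P) c + N b c = stepCost m N P c := by
  unfold stepCost
  rw [← Finset.add_sum_erase _ _ (mem_range.2 hb), ← Finset.add_sum_erase (range m) _ (mem_range.2 hb)]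
  simp only [List.mem_cons, true_or, if_true, hP, if_false, zero_add]
  rw [add_comm]
  congr 1
  refine Finset.sum_congr rfl fun x hx => ?_
  simp [(Finset.mem_erase.1 hx).1]

/-- Later step costs depend only on the set of earlier candidates. The sums on both sides avoid
truncated subtraction. -/
theorem prefixCost_append_congr {P P' : List ℕ} (h : ∀ b, b ∈ P ↔ b ∈ P') (l : List ℕ) :
    prefixCost m N (l ++ P) + prefixCost m N P' = prefixCost m N (l ++ P') + prefixCost m N P := by
  induction l with
  | nil => simp [add_comm]
  | cons c l ih =>
    simp only [List.cons_append, prefixCost]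
    rw [stepCost_congr (P := l ++ P) (P' := l ++ P') (by simp [h])]
    omega

/-- If the votes prefer `e` to its predecessor `b`, then exchanging the two lowers the cost. -/
theorem prefixCost_swap_lt {P l : List ℕ} {b e : ℕ} (hb : b < m) (he : e < m) (hbP : b ∉ P)
    (heP : e ∉ P) (h : N b e < N e b) :
    prefixCost m N (l ++ b :: e :: P) < prefixCost m N (l ++ e :: b :: P) := by
  have h1 := prefixCost_append_congr (m := m) (N := N) (P := b :: e :: P) (P' := e :: b :: P)
    (by simp [or_left_comm]) l
  have h2 := stepCost_cons (N := N) hb hbP e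
  have h3 := stepCost_cons (N := N) he heP b
  simp only [prefixCost] at h1
  omega

/-- A complete ranking of minimum cost is found by the search with its cost as budget. -/
theorem isNode_of_minimal {P : List ℕ} (hnd : P.Nodup) (hfull : ∀ c, c ∈ P ↔ c < m)
    (hmin : ∀ P' : List ℕ, P'.Perm P → prefixCost m N P ≤ prefixCost m N P')
    (hB : prefixCost m N P ≤ B) : IsNode m N B P := by
  -- The suffixes of `P` are the initial parts of the ranking; all of them are shown to be nodes.
  suffices H : ∀ P₀ l, P = l ++ P₀ → IsNode m N B P₀ from H P [] rfl
  have mono : ∀ (P₀ l : List ℕ), prefixCost m N P₀ ≤ prefixCost m N (l ++ P₀) := by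
    intro P₀ l
    induction l with
    | nil => simp
    | cons c l ih => simp only [List.cons_append, prefixCost]; omega
  intro P₀
  induction P₀ with
  | nil => intros; trivial
  | cons c P₀ ih =>
    intro l hl
    have hnd' := hl ▸ hnd
    have hcP : c ∉ P₀ := (List.nodup_cons.1 (List.nodup_append.1 hnd').2.1).1
    refine ⟨(hfull c).1 (by simp [hl]), ⟨hcP, ?_, ?_⟩, ih (l ++ [c]) (by simp [hl])⟩
    · intro e he hw
      by_contra hne
      have hel : e ∈ l := by
        have := (hfull e).2 he
        rw [hl] at this
        simpa [hne, hw.1] using this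
      obtain ⟨l₁, l₂, rfl⟩ := List.append_of_mem hel
      -- The winner `e` comes after `c`. Here `b` is the candidate chosen immediately before `e`,
      -- possibly `c` itself. It was still available when `e` was the winner, so exchanging `b` and
      -- `e` lowers the cost.
      obtain ⟨b, l₃, hb⟩ : ∃ b l₃, l₂ ++ [c] = b :: l₃ := by
        cases l₂ with
        | nil => exact ⟨c, [], rfl⟩
        | cons b l₂ => exact ⟨b, l₂ ++ [c], rfl⟩
      have hP : P = l₁ ++ e :: b :: (l₃ ++ P₀) := by
        rw [hl, ← List.cons_append (as := l₃), ← hb]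
        simp
      have hnd₂ := hP ▸ hnd
      have hnd₃ := (List.nodup_append.1 hnd₂).2.1
      simp only [List.nodup_cons, List.mem_cons, not_or] at hnd₃
      obtain ⟨⟨heb, he3⟩, hb3, -⟩ := hnd₃
      have hbm : b < m := (hfull b).1 (by simp [hP])
      have hlt := prefixCost_swap_lt (l := l₁) hbm he hb3 he3
        (hw.2 b hbm (fun h => hb3 (by simp [h])) (Ne.symm heb))
      rw [← hP] at hlt
      refine absurd (hmin _ ?_) (not_le.2 hlt)
      rw [hP]
      exact (List.Perm.swap e b _).append_left l₁
    · refine le_trans ?_ hB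
      rw [hl]
      exact mono (c :: P₀) l

/-- The cost as a sum over all pairs of candidates. -/
theorem prefixCost_eq_sum {P : List ℕ} (hP : P.Nodup) (hlt : ∀ c ∈ P, c < m) (hN : ∀ c, N c c = 0) :
    prefixCost m N P = ∑ c ∈ range m, ∑ b ∈ range m,
      if c ∈ P ∧ (b ∈ P → placeIn P c < placeIn P b) then N b c else 0 := by
  induction P with
  | nil => simp [prefixCost]
  | cons x P ih =>
    rw [List.nodup_cons] at hP
    have hx : x < m := hlt x (by simp)
    rw [prefixCost, ih hP.2 fun c hc => hlt c (by simp [hc]), stepCost,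
      ← Finset.add_sum_erase (range m) _ (mem_range.2 hx),
      ← Finset.add_sum_erase (range m) (fun c => ∑ b ∈ range m,
        if c ∈ x :: P ∧ (b ∈ x :: P → placeIn (x :: P) c < placeIn (x :: P) b) then N b c else 0)
        (mem_range.2 hx)]
    have e0 : (∑ b ∈ range m, if x ∈ P ∧ (b ∈ P → placeIn P x < placeIn P b) then N b x else 0)
        = 0 := by simp [hP.1]
    -- The new candidate `x` contributes its step cost as the row `c = x`. The other rows do not
    -- change, because `x` comes after all candidates of `P`, just as an unchosen one does.
    rw [e0, zero_add, add_comm]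
    congr 1
    · refine Finset.sum_congr rfl fun b _ => ?_
      by_cases hbx : b = x
      · subst hbx; simp [hN]
      · have := placeIn_le P b
        by_cases hbP : b ∈ P
        · simp [placeIn, hbx, hbP]; omega
        · simp [hbP, hbx]
    · refine Finset.sum_congr rfl fun c hc => Finset.sum_congr rfl fun b _ => ?_
      have hcx : c ≠ x := (Finset.mem_erase.1 hc).1
      by_cases hcP : c ∈ P
      · by_cases hbx : b = x
        · subst hbx
          have := placeIn_le P c
          simp [placeIn, hcx, hcP, hP.1]; omega
        · simp [placeIn, hcx, hcP, hbx]
      · simp [hcP, hcx]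

end Kemeny

namespace Kemeny

open Finset

/-! ## Votes -/

/-- Position of a candidate in a vote. -/
def place {m : ℕ} (v : Ranking m) (b : ℕ) : ℕ := if h : b < m then (v ⟨b, h⟩ : ℕ) else m

/-- Number of votes that prefer `b` to `c`. -/
def prefers {m : ℕ} (V : List (Ranking m)) (b c : ℕ) : ℕ :=
  (V.map fun v => if place v b < place v c then 1 else 0).sum

variable {m : ℕ}

theorem place_lt (v : Ranking m) {b : ℕ} (hb : b < m) : place v b < m := by
  simp [place, hb]

theorem place_injOn (v : Ranking m) {b c : ℕ} (hb : b < m) (hc : c < m)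
    (h : place v b = place v c) : b = c := by
  simp only [place, hb, hc, dif_pos] at h
  simpa using v.injective (Fin.ext h)

theorem prefers_self (V : List (Ranking m)) (c : ℕ) : prefers V c c = 0 := by
  simp [prefers]

theorem prefers_le (V : List (Ranking m)) (b c : ℕ) : prefers V b c ≤ V.length := by
  induction V with
  | nil => simp [prefers]
  | cons v V ih =>
    simp only [prefers, List.map_cons, List.sum_cons, List.length_cons] at ih ⊢
    split_ifs <;> omega

theorem prefers_add (V : List (Ranking m)) {b c : ℕ} (hb : b < m) (hc : c < m) (hbc : b ≠ c) :
    prefers V b c + prefers V c b = V.length := by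
  induction V with
  | nil => simp [prefers]
  | cons v V ih =>
    have : place v b ≠ place v c := fun h => hbc (place_injOn v hb hc h)
    simp only [prefers, List.map_cons, List.sum_cons, List.length_cons] at ih ⊢
    split_ifs <;> omega

/-! ### The weight inequality and the size of the search tree. -/

/-- Number of candidates outside `P` that the vote prefers to `c`. -/
def rankIn (v : Ranking m) (P : List ℕ) (c : ℕ) : ℕ :=
  ((range m).filter fun b => b ∉ P ∧ place v b < place v c).card

/-- Double counting of pairs of a vote and an unchosen candidate. It makes `stepCost / n` the mean
rank, to which Jensen's inequality applies. -/
theorem stepCost_prefers (V : List (Ranking m)) (P : List ℕ) (c : ℕ) :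
    stepCost m (prefers V) P c = (V.map fun v => rankIn v P c).sum := by
  induction V with
  | nil => simp [stepCost, prefers]
  | cons v V ih =>
    rw [List.map_cons, List.sum_cons, ← ih]
    simp only [stepCost, prefers, List.map_cons, List.sum_cons, rankIn, Finset.card_filter,
      ← Finset.sum_add_distrib]
    refine Finset.sum_congr rfl fun b _ => ?_
    by_cases h : b ∈ P <;> simp [h]

/-- The candidates that have not been chosen yet. -/
def remaining (m : ℕ) (P : List ℕ) : Finset ℕ := (range m).filter (· ∉ P)

theorem mem_remaining {P : List ℕ} {c : ℕ} : c ∈ remaining m P ↔ c < m ∧ c ∉ P := by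
  simp [remaining]

theorem rankIn_lt_of_place_lt (v : Ranking m) {P : List ℕ} {b c : ℕ} (hb : b ∈ remaining m P)
    (h : place v b < place v c) : rankIn v P b < rankIn v P c := by
  rw [mem_remaining] at hb
  refine Finset.card_lt_card ⟨fun x hx => ?_, fun hs => ?_⟩
  · simp only [mem_filter, mem_range] at hx ⊢
    exact ⟨hx.1, hx.2.1, hx.2.2.trans h⟩
  · have := hs (show b ∈ _ by simpa using ⟨hb.1, hb.2, h⟩)
    simp at this

theorem rankIn_injOn (v : Ranking m) (P : List ℕ) : Set.InjOn (rankIn v P) (remaining m P) := by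
  intro b hb c hc h
  rw [Finset.mem_coe] at hb hc
  rcases lt_trichotomy (place v b) (place v c) with h' | h' | h'
  · exact absurd h (rankIn_lt_of_place_lt v hb h').ne
  · exact place_injOn v (mem_remaining.1 hb).1 (mem_remaining.1 hc).1 h'
  · exact absurd h (rankIn_lt_of_place_lt v hc h').ne'

theorem sum_quarter_pow_le (s : Finset ℕ) : ∑ j ∈ s, (1 / 4 : ℝ) ^ j ≤ 4 / 3 := by
  have h := hasSum_geometric_of_lt_one (r := (1 / 4 : ℝ)) (by norm_num) (by norm_num)
  refine (sum_le_hasSum s (fun _ _ => by positivity) h).trans ?_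
  norm_num

/-- Distinct candidates have distinct ranks in one vote, so the sum is part of a geometric series.
-/
theorem sum_quarter_pow_rankIn_le (v : Ranking m) (P : List ℕ) :
    ∑ c ∈ remaining m P, (1 / 4 : ℝ) ^ rankIn v P c ≤ 4 / 3 := by
  rw [← Finset.sum_image (f := fun j => (1 / 4 : ℝ) ^ j) (rankIn_injOn v P)]
  exact sum_quarter_pow_le _

/-- Jensen's inequality for a list of exponents. -/
theorem length_mul_rpow_le {α : Type*} (V : List α) (f : α → ℕ) (x : ℝ)
    (hx : x * V.length = (V.map f).sum) :
    V.length * (1 / 4 : ℝ) ^ x ≤ (V.map fun v => (1 / 4 : ℝ) ^ f v).sum := by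
  -- The tangent at `x` lies below the convex function `(1 / 4) ^ k`. Since `x` is the mean of the
  -- exponents, the linear terms cancel in the sum.
  have key : ∀ k : ℕ, (1 / 4 : ℝ) ^ x * (1 + Real.log (1 / 4) * (k - x)) ≤ (1 / 4 : ℝ) ^ k := by
    intro k
    have h1 : (1 / 4 : ℝ) ^ k = (1 / 4 : ℝ) ^ x * (1 / 4 : ℝ) ^ ((k : ℝ) - x) := by
      rw [← Real.rpow_add (by norm_num), ← Real.rpow_natCast]
      congr 1
      ring
    rw [h1]
    refine mul_le_mul_of_nonneg_left ?_ (by positivity)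
    rw [Real.rpow_def_of_pos (by norm_num)]
    have := Real.add_one_le_exp (Real.log (1 / 4) * (k - x))
    linarith
  have H : ∀ W : List α, (1 / 4 : ℝ) ^ x *
      (W.length + Real.log (1 / 4) * ((W.map f).sum - W.length * x)) ≤
      (W.map fun v => (1 / 4 : ℝ) ^ f v).sum := by
    intro W
    induction W with
    | nil => simp
    | cons v W ih =>
      have := key (f v)
      simp only [List.map_cons, List.sum_cons, List.length_cons, Nat.cast_add, Nat.cast_one]
      linarith
  have := H V
  rw [← hx] at this
  convert this using 1
  ring

theorem sum_list_map_comm {α ι : Type*} (s : Finset ι) (V : List α) (g : ι → α → ℝ) :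
    ∑ c ∈ s, (V.map (g c)).sum = (V.map fun v => ∑ c ∈ s, g c v).sum := by
  induction V with
  | nil => simp
  | cons v V ih => simp [Finset.sum_add_distrib, ih]

/-- If there is no Condorcet winner, then every choice costs at least half of the votes. -/
theorem length_le_two_mul_stepCost {V : List (Ranking m)} {P : List ℕ} {c : ℕ}
    (hc : c ∈ remaining m P) (h : ¬ IsWinner m (prefers V) P c) :
    V.length ≤ 2 * stepCost m (prefers V) P c := by
  rw [mem_remaining] at hc
  simp only [IsWinner, not_and, not_forall, not_lt] at h
  obtain ⟨b, hb, hbP, hbc, hle⟩ := h hc.2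
  have h1 := prefers_add V hb hc.1 hbc
  have h2 : prefers V b c ≤ stepCost m (prefers V) P c := by
    have := Finset.single_le_sum (f := fun b => if b ∈ P then 0 else prefers V b c)
      (fun _ _ => Nat.zero_le _) (mem_range.2 hb)
    rwa [if_neg hbP] at this
  omega

/-- The choices that respect the Condorcet winner. -/
def choices (m : ℕ) (N : ℕ → ℕ → ℕ) (P : List ℕ) : Finset ℕ :=
  (remaining m P).filter fun c => ∀ e < m, IsWinner m N P e → e = c

/-- The core of the running time: passing to all children does not increase the total potential `16
^ (-cost / n)`. The base `16 = 4 * 4` provides two factors `4 ^ (-x)`, one for the bound `x ≥ 1/2`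
and one for the geometric series. -/
theorem sum_choices_le_one {V : List (Ranking m)} (hV : V ≠ []) (P : List ℕ) :
    ∑ c ∈ choices m (prefers V) P,
      (16 : ℝ) ^ (-(stepCost m (prefers V) P c / V.length : ℝ)) ≤ 1 := by
  have hn : (0 : ℝ) < V.length := by exact_mod_cast List.length_pos_iff.2 hV
  by_cases hw : ∃ e < m, IsWinner m (prefers V) P e
  · obtain ⟨e, he, hwe⟩ := hw
    have hsub : choices m (prefers V) P ⊆ {e} := fun c hc => by
      simpa using ((Finset.mem_filter.1 hc).2 e he hwe).symm
    refine (Finset.sum_le_sum_of_subset_of_nonneg hsub fun _ _ _ => by positivity).trans ?_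
    rw [Finset.sum_singleton]
    exact Real.rpow_le_one_of_one_le_of_nonpos (by norm_num) (by simp; positivity)
  · push Not at hw
    have h1 : ∀ c ∈ remaining m P, (16 : ℝ) ^ (-(stepCost m (prefers V) P c / V.length : ℝ)) ≤
        1 / (2 * V.length) * (V.map fun v => (1 / 4 : ℝ) ^ rankIn v P c).sum := by
      intro c hc
      set x : ℝ := stepCost m (prefers V) P c / V.length with hx
      have hx2 : 1 / 2 ≤ x := by
        have := length_le_two_mul_stepCost hc (hw c (mem_remaining.1 hc).1)
        have : (V.length : ℝ) ≤ 2 * stepCost m (prefers V) P c := by exact_mod_cast this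
        rw [hx, div_le_div_iff₀ (by norm_num) hn]
        linarith
      have h2 := length_mul_rpow_le V (fun v => rankIn v P c) x (by
        rw [hx, div_mul_cancel₀ _ hn.ne', stepCost_prefers])
      -- The first factor is at most `1/2` because `x ≥ 1/2`; Jensen's inequality is applied to the
      -- second one.
      have h3 : (16 : ℝ) ^ (-x) = (1 / 4) ^ x * (1 / 4) ^ x := by
        rw [← Real.mul_rpow (by norm_num) (by norm_num), Real.rpow_neg (by norm_num),
          ← Real.inv_rpow (by norm_num)]
        norm_num
      have h4 : (1 / 4 : ℝ) ^ x ≤ 1 / 2 := by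
        calc (1 / 4 : ℝ) ^ x ≤ (1 / 4 : ℝ) ^ (1 / 2 : ℝ) :=
              Real.rpow_le_rpow_of_exponent_ge (by norm_num) (by norm_num) hx2
          _ = 1 / 2 := by
              rw [← Real.sqrt_eq_rpow, show (1 / 4 : ℝ) = (1 / 2) ^ 2 by norm_num,
                Real.sqrt_sq (by norm_num)]
      have h5 : (0 : ℝ) ≤ (1 / 4) ^ x := by positivity
      rw [h3]
      calc (1 / 4 : ℝ) ^ x * (1 / 4) ^ x ≤ 1 / 2 * (1 / 4) ^ x :=
            mul_le_mul_of_nonneg_right h4 h5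
        _ = 1 / (2 * V.length) * (V.length * (1 / 4) ^ x) := by field_simp
        _ ≤ _ := mul_le_mul_of_nonneg_left h2 (by positivity)
    refine (Finset.sum_le_sum_of_subset_of_nonneg (Finset.filter_subset _ _)
      fun _ _ _ => by positivity).trans ((Finset.sum_le_sum h1).trans ?_)
    rw [← Finset.mul_sum, sum_list_map_comm]
    have h6 : (V.map fun v => ∑ c ∈ remaining m P, (1 / 4 : ℝ) ^ rankIn v P c).sum ≤
        V.length * (4 / 3) := by
      have := List.sum_le_card_nsmul
        (V.map fun v => ∑ c ∈ remaining m P, (1 / 4 : ℝ) ^ rankIn v P c) (4 / 3) (by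
          intro x hx
          obtain ⟨v, -, rfl⟩ := List.mem_map.1 hx
          exact sum_quarter_pow_rankIn_le v P)
      simpa using this
    calc _ ≤ 1 / (2 * V.length) * (V.length * (4 / 3) : ℝ) :=
          mul_le_mul_of_nonneg_left h6 (by positivity)
      _ = 2 / 3 := by field_simp; norm_num
      _ ≤ 1 := by norm_num

/-- By `sum_choices_le_one`, each of the `k + 1` levels contributes at most the potential of the top
node. That potential is at least `1` since the cost is within the budget, so it also pays for the
top node itself. -/
theorem treeSize_le {V : List (Ranking m)} (hV : V ≠ []) {B k : ℕ} {P : List ℕ}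
    (hP : prefixCost m (prefers V) P ≤ B) :
    (treeSize m (prefers V) B k P : ℝ) ≤
      (k + 1) * (16 : ℝ) ^ ((B - prefixCost m (prefers V) P : ℝ) / V.length) := by
  have hn : (0 : ℝ) < V.length := by exact_mod_cast List.length_pos_iff.2 hV
  have one_le : ∀ P, prefixCost m (prefers V) P ≤ B →
      (1 : ℝ) ≤ (16 : ℝ) ^ ((B - prefixCost m (prefers V) P : ℝ) / V.length) := by
    intro P hP
    refine Real.one_le_rpow (by norm_num) (div_nonneg ?_ hn.le)
    rw [sub_nonneg]
    exact_mod_cast hP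
  induction k generalizing P with
  | zero => simpa [treeSize] using one_le P hP
  | succ k ih =>
    set x := (16 : ℝ) ^ ((B - prefixCost m (prefers V) P : ℝ) / V.length) with hx
    have h1 : ((children m (prefers V) B P).map (treeSize m (prefers V) B k)).sum =
        ∑ c ∈ (range m).filter (fun c => Admissible m (prefers V) B P c),
          treeSize m (prefers V) B k (c :: P) := by
      rw [children, childrenUpTo, List.map_map, ← List.sum_toFinset _ (List.nodup_range.filter _)]
      refine Finset.sum_congr ?_ fun _ _ => rfl
      ext c
      simp
    have h2 : ∀ c ∈ (range m).filter (fun c => Admissible m (prefers V) B P c),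
        (treeSize m (prefers V) B k (c :: P) : ℝ) ≤
          (k + 1) * x * (16 : ℝ) ^ (-(stepCost m (prefers V) P c / V.length : ℝ)) := by
      intro c hc
      have hcB : prefixCost m (prefers V) (c :: P) ≤ B := (Finset.mem_filter.1 hc).2.2.2
      refine (ih hcB).trans (le_of_eq ?_)
      rw [mul_assoc, hx, ← Real.rpow_add (by norm_num), prefixCost]
      congr 2
      push_cast
      ring
    have h3 : (range m).filter (fun c => Admissible m (prefers V) B P c) ⊆
        choices m (prefers V) P := by
      intro c hc
      simp only [Finset.mem_filter, Finset.mem_range, choices, mem_remaining] at hc ⊢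
      exact ⟨⟨hc.1, hc.2.1⟩, hc.2.2.1⟩
    have h4 : (∑ c ∈ (range m).filter (fun c => Admissible m (prefers V) B P c),
        (treeSize m (prefers V) B k (c :: P) : ℝ)) ≤ (k + 1) * x := by
      refine (Finset.sum_le_sum h2).trans ?_
      rw [← Finset.mul_sum]
      refine mul_le_of_le_one_right (by positivity) ?_
      exact (Finset.sum_le_sum_of_subset_of_nonneg h3 fun _ _ _ => by positivity).trans
        (sum_choices_le_one hV P)
    have h5 := one_le P hP
    rw [treeSize, h1]
    push_cast
    linarith

end Kemeny

namespace RAM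

open Kemeny

/-! ## The search program -/

/-- Increase a scalar variable by one. -/
def incr (q : ℕ) : Program := setv q (.add (var q) (.lit 1))

/-- Entry `(a, b)` of the matrix of preferences. -/
def prefAt (a b : Expr) : Expr := .cell (entry 2 (.add (.mul a (var 0)) b))

/-- Position of the candidate `b` in the node number `q`. -/
def posAt (q b : Expr) : Expr := .cell (entry 3 (.add (.mul q (var 0)) b))

/-- Absolute difference. -/
def dist (a b : Expr) : Expr := .add (.sub a b) (.sub b a)

/-- Stores in `win` the Condorcet winner of the candidates that are not in the node `head`, or
`m` if there is none. -/
def findWinner : Program := block [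
  setv 10 (var 0),
  setv 3 (.lit 0),
  .loop (.sub (var 0) (var 3)) (block [
    .ite (posAt (var 8) (var 3)) .skip (block [
      setv 11 (.lit 1),
      setv 4 (.lit 0),
      .loop (.sub (var 0) (var 4)) (block [
        -- The product is nonzero iff `j` is unchosen (positions start at `1`), `j ≠ i`, and at
        -- least as many votes prefer `j` to `i` as the converse.
        .ite (.mul (.sub (.lit 1) (posAt (var 8) (var 4))) (.mul (dist (var 4) (var 3))
            (.sub (.add (prefAt (var 4) (var 3)) (.lit 1)) (prefAt (var 3) (var 4)))))
          (setv 11 (.lit 0)) .skip,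
        incr 4]),
      .ite (var 11) (setv 10 (var 3)) .skip]),
    incr 3])]

/-- Appends the child of the node `head` with the candidate `i` and the cost `acc`. -/
def push : Program := block [
  setv 4 (.lit 0),
  .loop (.sub (var 0) (var 4)) (block [
    store 3 (.add (.mul (var 9) (var 0)) (var 4)) (posAt (var 8) (var 4)),
    incr 4]),
  store 3 (.add (.mul (var 9) (var 0)) (var 3)) (.add (.cell (entry 4 (var 8))) (.lit 1)),
  store 4 (var 9) (.add (.cell (entry 4 (var 8))) (.lit 1)),
  store 5 (var 9) (var 11),
  incr 9]

/-- Appends the child of the node `head` with the candidate `i` if that is admissible. -/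
def tryChild : Program :=
  .ite (posAt (var 8) (var 3)) .skip
    -- Nonzero iff there is a Condorcet winner (`win ≠ m`) and it is not `i`.
    (.ite (.mul (dist (var 10) (var 0)) (dist (var 10) (var 3))) .skip (block [
      setv 11 (.cell (entry 5 (var 8))),
      setv 4 (.lit 0),
      .loop (.sub (var 0) (var 4)) (block [
        .ite (posAt (var 8) (var 4)) .skip
          (setv 11 (.add (var 11) (prefAt (var 4) (var 3)))),
        incr 4]),
      .ite (.sub (var 11) (var 6)) .skip push]))

/-- Appends all the children of the node `head`. -/
def expand : Program := block [
  findWinner,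
  setv 3 (.lit 0),
  .loop (.sub (var 0) (var 3)) (block [tryChild, incr 3])]

/-- Writes the ranking in the node `head`, unless sufficiently many have been written. -/
def emit : Program := block [
  setv 7 (.lit 0),
  .ite (var 2) (block [
    setv 2 (.sub (var 2) (.lit 1)),
    .write (var 0),
    setv 3 (.lit 0),
    .loop (.sub (var 0) (var 3)) (block [
      setv 4 (.lit 0),
      .loop (.sub (var 0) (var 4)) (block [
        .ite (dist (posAt (var 8) (var 4)) (.add (var 3) (.lit 1))) .skip (.write (var 4)),
        incr 4]),
      incr 3])]) .skip]

/-- Searches for the rankings whose cost is at most the budget. -/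
def search : Program := block [
  setv 8 (.lit 0),
  setv 9 (.lit 1),
  .loop (.sub (var 9) (var 8)) (block [
    .ite (.sub (var 0) (.cell (entry 4 (var 8)))) expand emit,
    incr 8])]

/-- Reads the votes and counts how many of them prefer one candidate to another one. -/
def readVotes : Program :=
  .loop (.sub (var 1) (var 3)) (block [
    setv 4 (.lit 0),
    .loop (.sub (var 0) (var 4)) (block [
      .read (entry 1 (var 4)),
      setv 5 (.lit 0),
      .loop (.sub (var 4) (var 5)) (block [
        store 2 (.add (.mul (.cell (entry 1 (var 5))) (var 0)) (.cell (entry 1 (var 4))))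
          (.add (prefAt (.cell (entry 1 (var 5))) (.cell (entry 1 (var 4)))) (.lit 1)),
        incr 5]),
      incr 4]),
    incr 3])

/-- The program: the budget is increased until a ranking is found. The votes are not read if there
are no candidates. -/
def kemenyProgram : Program := block [
  .read (.lit (8 * 0)),
  .read (.lit (8 * 1)),
  .read (.lit (8 * 2)),
  -- The factor is `0` if `m = 0` and `1` otherwise. Without candidates the votes take no space in
  -- the input, so `n` may be exponential in the input size and a loop over the votes would be too
  -- slow.
  setv 1 (.mul (var 1) (.sub (.lit 1) (.sub (.lit 1) (var 0)))),
  readVotes,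
  setv 7 (var 2),
  .loop (var 7) (block [search, incr 6])]

/-! ### Correctness and step counts of the search subroutines. -/

variable {X : ℕ} {s : Store} {m : ℕ} {N : ℕ → ℕ → ℕ} {B : ℕ} {P : List ℕ}

@[simp] theorem val_prefAt (a b : Expr) :
    (prefAt a b).val s = s.pref (a.val s * s.m + b.val s) := by
  simp [prefAt]

@[simp] theorem val_posAt (a b : Expr) :
    (posAt a b).val s = s.pos (a.val s * s.m + b.val s) := by
  simp [posAt]

@[simp] theorem val_dist (a b : Expr) :
    (dist a b).val s = (a.val s - b.val s) + (b.val s - a.val s) := by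
  simp [dist]

theorem reaches_findWinner (hm : s.m = m) (hmX : m < X)
    (hpref : ∀ a < m, ∀ b < m, s.pref (a * m + b) = N a b)
    (hpos : ∀ b < m, s.pos (s.head * m + b) = placeIn P b) :
    Reaches X findWinner s (20 * (m + 1) ^ 2) fun s' => ∃ i j acc w,
      s' = { s with i := i, j := j, acc := acc, win := w } ∧
      ((w = m ∧ ∀ e < m, ¬ IsWinner m N P e) ∨ (w < m ∧ IsWinner m N P w)) := by
  refine Reaches.weaken (k := m * (9 * m + 14) + 4) ?_ (by nlinarith)
  refine reaches_cons (reaches_set_win (by simp; omega) ?_)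
  refine reaches_cons (reaches_set_i (by simp) ?_)
  refine reaches_block (k₁ := m * (9 * m + 14) + 1) (k₂ := 1) ?_ le_rfl
  refine Reaches.imp (reaches_loop (k := 9 * m + 13) m (fun c s' => ∃ j acc w,
    s' = { s with i := c, j := j, acc := acc, win := w } ∧
    ((w = m ∧ ∀ e < c, ¬ IsWinner m N P e) ∨ (w < m ∧ IsWinner m N P w)))
    ?_ ?_ ?_) ?_
  · exact ⟨s.j, s.acc, m, by simp [hm], by simp⟩
  · rintro s' ⟨j, acc, w, rfl, -⟩; simp [hm]
  · rintro c hc s' ⟨j, acc, w, rfl, hw⟩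
    refine ⟨by simp [hm]; omega, ?_⟩
    refine reaches_block (k₁ := 9 * m + 11) (k₂ := 2) (reaches_ite ?_ ?_) le_rfl
    · intro h
      simp only [val_posAt, val_head, val_i, hm, hpos c hc] at h
      refine reaches_skip ?_
      refine reaches_cons (reaches_set_i (by simp; omega) (reaches_nil ?_))
      refine ⟨j, acc, w, by simp, hw.imp_left fun hw => ⟨hw.1, fun e he => ?_⟩⟩
      rcases Nat.lt_succ_iff_lt_or_eq.1 he with he | rfl
      · exact hw.2 e he
      · exact fun hW => h (placeIn_eq_zero.2 hW.1)
    · intro h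
      simp only [val_posAt, val_head, val_i, hm, hpos c hc, placeIn_eq_zero] at h
      refine reaches_cons (reaches_set_acc (by simp; omega) ?_)
      refine reaches_cons (reaches_set_j (by simp) ?_)
      refine reaches_block (k₁ := m * 9 + 1) (k₂ := 7) ?_ (by omega)
      refine Reaches.imp (reaches_loop (k := 8) m (fun d s' => ∃ acc,
        s' = { s with i := c, j := d, acc := acc, win := w } ∧
        (acc ≠ 0 ↔ ∀ b < d, b ∉ P → b ≠ c → N b c < N c b)) ?_ ?_ ?_) ?_
      · exact ⟨1, by simp, by simp⟩
      · rintro s' ⟨acc, rfl, -⟩; simp [hm]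
      · rintro d hd s' ⟨acc, rfl, hacc⟩
        refine ⟨by simp [hm]; omega, ?_⟩
        refine reaches_block (k₁ := 2) (k₂ := 6) (reaches_ite ?_ ?_) le_rfl
        · intro h1
          simp only [val_mul, val_sub, val_lit, val_posAt, val_head, val_j, val_dist,
            val_i, val_add, val_prefAt, hm, hpos d hd, hpref d hd c hc,
            hpref c hc d hd, mul_ne_zero_iff] at h1
          refine reaches_set_acc (by simp) ?_
          refine reaches_cons (reaches_set_j (by simp; omega) (reaches_nil ?_))
          refine ⟨0, by simp, ?_⟩
          simp only [ne_eq, not_true_eq_false, false_iff, not_forall]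
          exact ⟨d, by omega, placeIn_eq_zero.1 (by omega), by omega, by omega⟩
        · intro h1
          simp only [val_mul, val_sub, val_lit, val_posAt, val_head, val_j, val_dist,
            val_i, val_add, val_prefAt, hm, hpos d hd, hpref d hd c hc,
            hpref c hc d hd, mul_eq_zero] at h1
          refine reaches_skip ?_
          refine reaches_cons (reaches_set_j (by simp; omega) (reaches_nil ?_))
          refine ⟨acc, by simp, hacc.trans ⟨fun h2 b hb hbP hbc => ?_,
            fun h2 b hb => h2 b (by omega)⟩⟩
          rcases Nat.lt_succ_iff_lt_or_eq.1 hb with hb | rfl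
          · exact h2 b hb hbP hbc
          · have := placeIn_eq_zero.2 hbP
            omega
      · rintro s' ⟨acc, rfl, hacc⟩
        refine reaches_block (k₁ := 2) (k₂ := 5) (reaches_ite ?_ ?_) le_rfl
        · intro h1
          refine reaches_set_win (by simp; omega) (reaches_nil ?_)
          refine reaches_cons (reaches_set_i (by simp; omega) (reaches_nil ?_))
          exact ⟨m, acc, c, by simp, Or.inr ⟨hc, h, hacc.1 (by simpa using h1)⟩⟩
        · intro h1
          refine reaches_skip (reaches_nil ?_)
          refine reaches_cons (reaches_set_i (by simp; omega) (reaches_nil ?_))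
          refine ⟨m, acc, w, by simp, hw.imp_left fun hw => ⟨hw.1, fun e he => ?_⟩⟩
          rcases Nat.lt_succ_iff_lt_or_eq.1 he with he | rfl
          · exact hw.2 e he
          · exact fun hW => hacc.2 hW.2 (by simpa using h1)
  · rintro s' ⟨j, acc, w, rfl, h⟩
    exact reaches_nil ⟨m, j, acc, w, rfl, h⟩

/-- The node number `q` is `P`. -/
def IsRow (m : ℕ) (N : ℕ → ℕ → ℕ) (s : Store) (q : ℕ) (P : List ℕ) : Prop :=
  (∀ b < m, s.pos (q * m + b) = placeIn P b) ∧ s.len q = P.length ∧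
    s.cst q = prefixCost m N P

/-- The nodes from the number `q` on are those in the list `l`. -/
def IsQueue (m : ℕ) (N : ℕ → ℕ → ℕ) (s : Store) (q : ℕ) (l : List (List ℕ)) : Prop :=
  ∀ t P, l[t]? = some P → IsRow m N s (q + t) P

theorem IsQueue.append {q : ℕ} {l l' : List (List ℕ)} (h : IsQueue m N s q l)
    (h' : IsQueue m N s (q + l.length) l') : IsQueue m N s q (l ++ l') := by
  intro t P ht
  rw [List.getElem?_append] at ht
  split_ifs at ht with hl
  · exact h t P ht
  · have := h' _ P ht
    rwa [show q + l.length + (t - l.length) = q + t by omega] at this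

theorem isQueue_nil {q : ℕ} : IsQueue m N s q [] := by
  intro t P ht
  simp at ht

theorem isQueue_singleton {q : ℕ} (h : IsRow m N s q P) : IsQueue m N s q [P] := by
  intro t P' ht
  cases t with
  | zero => simpa [← show P = P' by simpa using ht] using h
  | succ t => simp at ht

theorem row_index_lt {q t b : ℕ} (h : q < t) (hb : b < m) : q * m + b < t * m :=
  calc q * m + b < (q + 1) * m := by rw [add_mul]; omega
    _ ≤ t * m := Nat.mul_le_mul_right _ h

/-- All entries of the new row, its length and its cost are overwritten, so remains of searches with
smaller budgets do no harm. Rows with smaller numbers occupy disjoint cells by `row_index_lt`. -/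
theorem reaches_push {c : ℕ} (hm : s.m = m) (hmX : m < X) (hi : s.i = c)
    (hrow : IsRow m N s s.head P) (hlen : P.length < m) (hht : s.head < s.tail)
    (htX : s.tail < X) (hacc : s.acc = prefixCost m N (c :: P)) (haX : s.acc ≤ X) :
    Reaches X push s (8 * m + 10) fun s' => ∃ j pos len cst,
      s' = { s with j := j, pos := pos, len := len, cst := cst, tail := s.tail + 1 } ∧
      (∀ q < s.tail, ∀ P', IsRow m N s q P' → IsRow m N s' q P') ∧
      IsRow m N s' s.tail (c :: P) := by
  refine Reaches.weaken (k := m * 4 + 10) ?_ (by omega)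
  refine reaches_cons (reaches_set_j (by simp) ?_)
  refine reaches_block (k₁ := m * 4 + 1) (k₂ := 8) ?_ (by omega)
  refine Reaches.imp (reaches_loop (k := 3) m (fun d s' => ∃ pos,
    s' = { s with j := d, pos := pos } ∧
    (∀ q < s.tail, ∀ b < m, pos (q * m + b) = s.pos (q * m + b)) ∧
    ∀ b < d, pos (s.tail * m + b) = placeIn P b) ?_ ?_ ?_) ?_
  · exact ⟨s.pos, by simp, by simp, by simp⟩
  · rintro s' ⟨pos, rfl, -⟩; simp [hm]
  · rintro d hd s' ⟨pos, rfl, h1, h2⟩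
    have hv : pos (s.head * m + d) = placeIn P d := by rw [h1 _ hht _ hd, hrow.1 d hd]
    have := placeIn_le P d
    refine ⟨by simp [hm]; omega, ?_⟩
    refine reaches_cons (reaches_store_pos (by simp [hm, hv]; omega) ?_)
    refine reaches_cons (reaches_set_j (by simp; omega) (reaches_nil ?_))
    simp only [val_add, val_mul, val_tail, val_m, val_j, val_posAt, val_head, val_lit, hm, hv]
    refine ⟨_, rfl, fun q hq b hb => ?_, fun b hb => ?_⟩
    · have := row_index_lt hq hb
      rw [Function.update_apply, if_neg (by omega), h1 q hq b hb]
    · simp only [Function.update_apply]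
      split_ifs with h
      · rw [show b = d by omega]
      · exact h2 b (by omega)
  · rintro s' ⟨pos, rfl, h1, h2⟩
    refine reaches_cons (reaches_store_pos (by simp [hrow.2.1]; omega) ?_)
    refine reaches_cons (reaches_store_len (by simp [hrow.2.1]; omega) ?_)
    refine reaches_cons (reaches_store_cst (by simpa using haX) ?_)
    refine reaches_cons (reaches_set_tail (by simpa using htX) (reaches_nil ?_))
    simp only [val_add, val_mul, val_tail, val_m, val_i, val_len, val_head, val_lit, val_acc, hm, hi,
      hrow.2.1, hacc]
    refine ⟨_, _, _, _, rfl, fun q hq P' hP' => ⟨fun b hb => ?_, ?_, ?_⟩, fun b hb => ?_, ?_, ?_⟩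
    · have := row_index_lt hq hb
      simp only [Function.update_apply]
      rw [if_neg (by omega), h1 q hq b hb, hP'.1 b hb]
    · simp only [Function.update_apply]
      rw [if_neg (by omega), hP'.2.1]
    · simp only [Function.update_apply]
      rw [if_neg (by omega), hP'.2.2]
    · simp only [Function.update_apply, placeIn, Nat.add_left_cancel_iff]
      split_ifs with h
      · rfl
      · exact h2 b hb
    · simp
    · simp

theorem reaches_tryChild {c : ℕ} (hm : s.m = m) (hmX : m < X) (hi : s.i = c) (hc : c < m)
    (hB : s.bud = B) (hpref : ∀ a < m, ∀ b < m, s.pref (a * m + b) = N a b)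
    (hrow : IsRow m N s s.head P) (hlen : P.length < m) (hht : s.head < s.tail)
    (htX : s.tail + (childFor m N B P c).length ≤ X)
    (hX : prefixCost m N P + stepCost m N P c ≤ X)
    (hwin : (s.win = m ∧ ∀ e < m, ¬ IsWinner m N P e) ∨ (s.win < m ∧ IsWinner m N P s.win)) :
    Reaches X tryChild s (20 * m + 20) fun s' => ∃ j acc pos len cst,
      s' = { s with j := j, acc := acc, pos := pos, len := len, cst := cst,
                    tail := s.tail + (childFor m N B P c).length } ∧
      (∀ q < s.tail, ∀ P', IsRow m N s q P' → IsRow m N s' q P') ∧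
      IsQueue m N s' s.tail (childFor m N B P c) := by
  -- Every rejection leaves the queue as it is and changes at most the auxiliary variables.
  have hno : ¬ Admissible m N B P c → ∀ j acc, ∃ j' acc' pos len cst,
      { s with j := j, acc := acc } =
        { s with j := j', acc := acc', pos := pos, len := len, cst := cst,
                 tail := s.tail + (childFor m N B P c).length } ∧
      (∀ q < s.tail, ∀ P', IsRow m N s q P' → IsRow m N { s with j := j, acc := acc } q P') ∧
      IsQueue m N { s with j := j, acc := acc } s.tail (childFor m N B P c) := by
    intro h j acc
    rw [childFor, if_neg h]
    exact ⟨j, acc, s.pos, s.len, s.cst, rfl, fun _ _ _ h => h, isQueue_nil⟩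
  refine reaches_ite ?_ ?_
  · intro h
    simp only [val_posAt, val_head, val_i, hm, hi, hrow.1 c hc] at h
    exact reaches_skip (hno (fun h' => h (placeIn_eq_zero.2 h'.1)) s.j s.acc)
  intro h
  simp only [val_posAt, val_head, val_i, hm, hi, hrow.1 c hc, placeIn_eq_zero] at h
  refine reaches_ite ?_ ?_
  · intro h1
    simp only [val_mul, val_dist, val_win, val_m, val_i, hi, hm, mul_ne_zero_iff] at h1
    refine reaches_skip (hno (fun h' => ?_) s.j s.acc)
    rcases hwin with hw | hw
    · omega
    · have := h'.2.1 _ hw.1 hw.2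
      omega
  intro h1
  simp only [val_mul, val_dist, val_win, val_m, val_i, hi, hm, mul_eq_zero] at h1
  -- The machine compares `c` with the one winner that it has found; two different winners would
  -- each have to beat the other.
  have h2 : ∀ e < m, IsWinner m N P e → e = c := by
    intro e he hWe
    rcases hwin with hw | hw
    · exact absurd hWe (hw.2 e he)
    · by_contra hne
      have e1 : s.win = c := by omega
      rw [e1] at hw
      have e2 := hWe.2 c hc h (Ne.symm hne)
      have e3 := hw.2.2 e he hWe.1 hne
      omega
  refine reaches_cons (reaches_set_acc (by simp [hrow.2.2]; omega) ?_)
  refine reaches_cons (reaches_set_j (by simp) ?_)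
  refine reaches_block (k₁ := m * 9 + 1) (k₂ := 8 * m + 13) ?_ (by omega)
  refine Reaches.imp (reaches_loop (k := 8) m (fun d s' =>
    s' = { s with j := d, acc := prefixCost m N P + ∑ b ∈ Finset.range d,
      if b ∈ P then 0 else N b c }) ?_ ?_ ?_) ?_
  · simp [hrow.2.2]
  · rintro s' rfl; simp [hm]
  · rintro d hd s' rfl
    refine ⟨by simp [hm]; omega, ?_⟩
    refine reaches_block (k₁ := 2) (k₂ := 6) (reaches_ite ?_ ?_) le_rfl
    · intro h3
      simp only [val_posAt, val_head, val_j, hm, hrow.1 d hd, ne_eq, placeIn_eq_zero,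
        not_not] at h3
      refine reaches_skip (reaches_cons (reaches_set_j (by simp; omega) (reaches_nil ?_)))
      simp [Finset.sum_range_succ, h3]
    · intro h3
      simp only [val_posAt, val_head, val_j, hm, hrow.1 d hd, placeIn_eq_zero] at h3
      refine reaches_set_acc ?_ (reaches_cons (reaches_set_j (by simp; omega) (reaches_nil ?_)))
      · have h4 : ∑ b ∈ Finset.range (d + 1), (if b ∈ P then 0 else N b c) ≤ stepCost m N P c :=
          Finset.sum_le_sum_of_subset (Finset.range_mono (by omega))
        rw [Finset.sum_range_succ, if_neg h3] at h4
        simp only [val_add, val_acc, val_prefAt, val_j, val_i, hm, hi, hpref d hd c hc]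
        omega
      · simp [Finset.sum_range_succ, h3, hm, hi, hpref d hd c hc, add_assoc]
  · rintro s' rfl
    have hsum : ∑ b ∈ Finset.range m, (if b ∈ P then 0 else N b c) = stepCost m N P c := rfl
    refine reaches_block (k₁ := 8 * m + 11) (k₂ := 1) (reaches_ite ?_ ?_) (by omega)
    · intro h3
      simp only [val_sub, val_acc, val_bud, hB, hsum] at h3
      exact reaches_skip (reaches_nil (hno (fun h' => h3 (by have := h'.2.2; omega)) _ _))
    · intro h3
      simp only [val_sub, val_acc, val_bud, hB, hsum] at h3
      have hadm : Admissible m N B P c := ⟨h, h2, by omega⟩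
      have e : childFor m N B P c = [c :: P] := if_pos hadm
      rw [e, List.length_singleton] at htX ⊢
      refine Reaches.imp (reaches_push (N := N) (P := P) hm hmX hi hrow hlen hht htX rfl hX) ?_
      rintro s' ⟨j, pos, len, cst, rfl, h4, h5⟩
      exact reaches_nil ⟨_, _, _, _, _, rfl, h4, isQueue_singleton h5⟩

theorem IsQueue.frame {s' : Store} {q t : ℕ} {l : List (List ℕ)} (h : IsQueue m N s q l)
    (ht : q + l.length ≤ t) (hs : ∀ q < t, ∀ P, IsRow m N s q P → IsRow m N s' q P) :
    IsQueue m N s' q l := by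
  intro i P hi
  have := (List.getElem?_eq_some_iff.1 hi).1
  exact hs _ (by omega) _ (h i P hi)

theorem IsQueue.head {q : ℕ} {l : List (List ℕ)} (h : IsQueue m N s q (P :: l)) :
    IsRow m N s q P := h 0 P rfl

theorem IsQueue.tail {q : ℕ} {l : List (List ℕ)} (h : IsQueue m N s q (P :: l)) :
    IsQueue m N s (q + 1) l := by
  intro t P' ht
  have := h (t + 1) P' (by simpa using ht)
  rwa [show q + 1 + t = q + (t + 1) by ring]

theorem reaches_expand (hm : s.m = m) (hmX : m < X)
    (hB : s.bud = B) (hpref : ∀ a < m, ∀ b < m, s.pref (a * m + b) = N a b)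
    (hrow : IsRow m N s s.head P) (hlen : P.length < m) (hht : s.head < s.tail)
    (htX : s.tail + (children m N B P).length ≤ X)
    (hX : ∀ c < m, prefixCost m N P + stepCost m N P c ≤ X) :
    Reaches X expand s (50 * (m + 1) ^ 2) fun s' => ∃ i j acc win pos len cst,
      s' = { s with i := i, j := j, acc := acc, win := win, pos := pos, len := len, cst := cst,
                    tail := s.tail + (children m N B P).length } ∧
      (∀ q < s.tail, ∀ P', IsRow m N s q P' → IsRow m N s' q P') ∧
      IsQueue m N s' s.tail (children m N B P) := by
  refine reaches_block (k₁ := 20 * (m + 1) ^ 2) (k₂ := m * (20 * m + 25) + 3) ?_ (by nlinarith)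
  refine (reaches_findWinner (N := N) (P := P) hm hmX hpref hrow.1).imp ?_
  rintro s' ⟨i, j, acc, w, rfl, hw⟩
  refine reaches_cons (reaches_set_i (by simp) ?_)
  refine reaches_block (k₁ := m * (20 * m + 25) + 1) (k₂ := 1) ?_ le_rfl
  refine Reaches.imp (reaches_loop (k := 20 * m + 24) m (fun c s' => ∃ j acc pos len cst,
      s' = { s with i := c, j := j, acc := acc, win := w, pos := pos, len := len, cst := cst,
                    tail := s.tail + (childrenUpTo m N B P c).length } ∧
      (∀ q < s.tail, ∀ P', IsRow m N s q P' → IsRow m N s' q P') ∧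
      IsQueue m N s' s.tail (childrenUpTo m N B P c)) ?_ ?_ ?_) ?_
  · exact ⟨_, _, _, _, _, rfl, fun _ _ _ h => h, isQueue_nil⟩
  · rintro s' ⟨j, acc, pos, len, cst, rfl, -⟩; simp [hm]
  · rintro c hc s' ⟨j, acc, pos, len, cst, rfl, h1, h2⟩
    refine ⟨by simp [hm]; omega, ?_⟩
    have hle : (childrenUpTo m N B P (c + 1)).length ≤ (children m N B P).length := by
      simp only [childrenUpTo, List.length_map, ← List.countP_eq_length_filter]
      exact List.Sublist.countP_le (List.range_sublist.2 hc)
    rw [childrenUpTo_succ, List.length_append] at hle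
    refine reaches_block (k₁ := 20 * m + 20) (k₂ := 2) ?_ (by omega)
    refine Reaches.imp (reaches_tryChild (N := N) (B := B) (P := P) (c := c) hm hmX rfl hc hB hpref
      (h1 _ hht _ hrow) hlen (by simp only; omega) (by simp only; omega) (hX c hc) hw) ?_
    rintro s' ⟨j, acc, pos, len, cst, rfl, h3, h4⟩
    refine reaches_cons (reaches_set_i (by simp; omega) (reaches_nil ?_))
    simp only [val_add, val_i, val_lit]
    refine ⟨j, acc, pos, len, cst, ?_, fun q hq P' hP' => h3 q ?_ P' (h1 q hq P' hP'), ?_⟩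
    · simp only [childrenUpTo_succ, List.length_append, add_assoc]
    · simp only; omega
    · rw [childrenUpTo_succ]
      exact IsQueue.append (h2.frame le_rfl h3) h4
  · rintro s' ⟨j, acc, pos, len, cst, rfl, h1, h2⟩
    exact reaches_nil ⟨m, j, acc, w, pos, len, cst, rfl, h1, h2⟩

theorem reaches_emit (hm : s.m = m) (hmX : m < X) (hrow : IsRow m N s s.head P)
    (hlen : P.length = m) (hnd : P.Nodup) (hlt : ∀ c ∈ P, c < m) :
    Reaches X emit s (50 * (m + 1) ^ 2) fun s' => ∃ i j,
      s' = { s with i := i, j := j, go := 0, r := s.r - 1,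
                    out := s.out ++ if s.r = 0 then [] else m :: P.reverse } := by
  refine Reaches.weaken (k := m * (m * 9 + 13) + 10) ?_ (by nlinarith)
  refine reaches_cons (reaches_set_go (by simp) ?_)
  refine reaches_block (k₁ := m * (m * 9 + 13) + 8) (k₂ := 1) (reaches_ite ?_ ?_) le_rfl
  · intro h
    simp only [val_r] at h
    refine Reaches.of_bounded fun hb => ?_
    refine reaches_cons (reaches_set_r ?_ ?_)
    · have h1 := hb.1 (8 * 2)
      rw [show (8 * 2 : ℕ) = 8 * 2 + 0 from rfl, Store.mem_entry _ (by norm_num)] at h1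
      simp only [Store.array, Store.scalar] at h1
      simp
      omega
    refine reaches_cons (reaches_write ?_)
    refine reaches_cons (reaches_set_i (by simp) ?_)
    refine reaches_block (k₁ := m * (m * 9 + 13) + 1) (k₂ := 1) ?_ (by omega)
    refine Reaches.imp (reaches_loop (k := m * 9 + 12) m (fun c s' => ∃ j,
      s' = { s with i := c, j := j, go := 0, r := s.r - 1,
                    out := s.out ++ m :: P.reverse.take c }) ?_ ?_ ?_) ?_
    · exact ⟨s.j, by simp [hm]⟩
    · rintro s' ⟨j, rfl⟩; simp [hm]
    · rintro c hc s' ⟨j, rfl⟩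
      refine ⟨by simp [hm]; omega, ?_⟩
      have hcP : c < P.reverse.length := by simpa [hlen] using hc
      refine reaches_cons (reaches_set_j (by simp) ?_)
      refine reaches_block (k₁ := m * 9 + 1) (k₂ := 2) ?_ (by omega)
      -- Only positions are stored, so each place `c` is filled by scanning all candidates; the
      -- right one is written when the scan passes it.
      refine Reaches.imp (reaches_loop (k := 8) m (fun d s' =>
        s' = { s with i := c, j := d, go := 0, r := s.r - 1,
                      out := s.out ++ (m :: P.reverse.take c) ++
                        if P.reverse[c] < d then [P.reverse[c]] else [] }) ?_ ?_ ?_) ?_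
      · simp
      · rintro s' rfl; simp [hm]
      · rintro d hd s' rfl
        refine ⟨by simp [hm]; omega, ?_⟩
        have hpl := placeIn_eq_succ hnd (show c < P.length by omega) (b := d)
        refine reaches_block (k₁ := 2) (k₂ := 6) (reaches_ite ?_ ?_) le_rfl
        · intro h1
          simp only [val_dist, val_posAt, val_head, val_j, val_add, val_i, val_lit, hm,
            hrow.1 d hd] at h1
          refine reaches_skip (reaches_cons (reaches_set_j (by simp; omega) (reaches_nil ?_)))
          have h2 : P.reverse[c] ≠ d := fun h => by have := hpl.2 h; omega
          have h3 : P.reverse[c] < d + 1 ↔ P.reverse[c] < d := by omega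
          simp only [val_add, val_j, val_lit, h3]
        · intro h1
          simp only [val_dist, val_posAt, val_head, val_j, val_add, val_i, val_lit, hm,
            hrow.1 d hd] at h1
          refine reaches_write (reaches_cons (reaches_set_j (by simp; omega) (reaches_nil ?_)))
          have h2 : P.reverse[c] = d := hpl.1 (by omega)
          simp [h2]
      · rintro s' rfl
        refine reaches_cons (reaches_set_i (by simp; omega) (reaches_nil ⟨m, ?_⟩))
        have h1 : P.reverse[c] < m := hlt _ (List.mem_reverse.1 (List.getElem_mem hcP))
        simp only [val_add, val_i, val_lit, if_pos h1, List.append_assoc, List.cons_append,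
          List.take_append_getElem hcP]
    · rintro s' ⟨j, rfl⟩
      refine reaches_nil (reaches_nil ⟨m, j, ?_⟩)
      rw [if_neg h, List.take_of_length_le (by simp [hlen])]
  · intro h
    simp only [val_r] at h
    refine reaches_skip (reaches_nil ⟨s.i, s.j, ?_⟩)
    simp [h]

/-! ### Breadth-first search. -/

/-- Number of nodes of the subtrees of the nodes in a list. -/
def totalSize (m : ℕ) (N : ℕ → ℕ → ℕ) (B : ℕ) (l : List (List ℕ)) : ℕ :=
  (l.map fun P => treeSize m N B (m - P.length) P).sum

theorem length_le_totalSize (l : List (List ℕ)) : l.length ≤ totalSize m N B l := by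
  induction l with
  | nil => simp
  | cons P l ih =>
    have := treeSize_pos (m := m) (N := N) (B := B) (m - P.length) P
    simp only [totalSize, List.map_cons, List.sum_cons, List.length_cons] at ih ⊢
    omega

/-- The complete rankings below the nodes in a list. -/
def allLeaves (m : ℕ) (N : ℕ → ℕ → ℕ) (B : ℕ) (l : List (List ℕ)) : List (List ℕ) :=
  l.flatMap fun P => leaves m N B (m - P.length) P

theorem length_of_mem_children {P' : List ℕ} (h : P' ∈ children m N B P) :
    P'.length = P.length + 1 := by
  obtain ⟨c, -, -, rfl⟩ := mem_childrenUpTo.1 h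
  rfl

theorem treeSize_eq_totalSize (h : P.length < m) :
    treeSize m N B (m - P.length) P = 1 + totalSize m N B (children m N B P) := by
  obtain ⟨k, hk⟩ : ∃ k, m - P.length = k + 1 := ⟨m - P.length - 1, by omega⟩
  rw [hk, treeSize, totalSize]
  congr 2
  refine List.map_congr_left fun P' hP' => ?_
  rw [length_of_mem_children hP', show m - (P.length + 1) = k by omega]

theorem leaves_eq_allLeaves (h : P.length < m) :
    leaves m N B (m - P.length) P = allLeaves m N B (children m N B P) := by
  obtain ⟨k, hk⟩ : ∃ k, m - P.length = k + 1 := ⟨m - P.length - 1, by omega⟩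
  rw [hk, leaves, allLeaves]
  refine List.flatMap_congr fun P' hP' => ?_
  rw [length_of_mem_children hP', show m - (P.length + 1) = k by omega]

/-- The numbers written for a list of rankings. -/
def written (m : ℕ) (E : List (List ℕ)) : List ℕ := E.flatMap fun P => m :: P.reverse

/-- Each iteration removes one node from the queue, so there are exactly `T` of them. The list `E`
collects all rankings met, of which only the first `s.r` are written. The root row survives, ready
for the search with the next budget. -/
theorem reaches_search {T : ℕ} (hm : s.m = m) (hmX : m < X)
    (hB : s.bud = B) (hpref : ∀ a < m, ∀ b < m, s.pref (a * m + b) = N a b)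
    (hroot : IsRow m N s 0 []) (hT : treeSize m N B m [] = T) (hTX : T ≤ X)
    (hX : ∀ P, ∀ c < m, B + stepCost m N P c ≤ X) :
    Reaches X search s (T * (50 * (m + 1) ^ 2 + 4) + 5) fun s' =>
      ∃ i j acc win pos len cst head tail E,
        s' = { s with i := i, j := j, acc := acc, win := win, pos := pos, len := len, cst := cst,
                      head := head, tail := tail, r := s.r - E.length,
                      go := if E = [] then s.go else 0,
                      out := s.out ++ written m (E.take s.r) } ∧
        E.Perm (leaves m N B m []) ∧ IsRow m N s' 0 [] := by
  have hT0 : 1 ≤ T := hT ▸ treeSize_pos _ _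
  refine reaches_cons (reaches_set_head (by simp) ?_)
  refine reaches_cons (reaches_set_tail (by simp; omega) ?_)
  refine reaches_block (k₁ := T * (50 * (m + 1) ^ 2 + 4) + 1) (k₂ := 1) ?_ (by omega)
  -- Here `l` is the queue. Two quantities are conserved: the rankings met together with the leaves
  -- below `l`, up to order, and the number of processed nodes plus the sizes of the pending
  -- subtrees.
  refine Reaches.imp (reaches_loop (k := 50 * (m + 1) ^ 2 + 3) T (fun a s' =>
    ∃ i j acc win pos len cst l E,
        s' = { s with i := i, j := j, acc := acc, win := win, pos := pos, len := len, cst := cst,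
                      head := a, tail := a + l.length, r := s.r - E.length,
                      go := if E = [] then s.go else 0,
                      out := s.out ++ written m (E.take s.r) } ∧
        (E ++ allLeaves m N B l).Perm (leaves m N B m []) ∧ IsRow m N s' 0 [] ∧
        IsQueue m N s' a l ∧ a + totalSize m N B l = T ∧ (∀ P ∈ l, IsNode m N B P) ∧
        0 < a + l.length) ?_ ?_ ?_) ?_
  · refine ⟨s.i, s.j, s.acc, s.win, s.pos, s.len, s.cst, [[]], [], ?_, ?_, hroot,
      isQueue_singleton hroot, ?_, ?_, ?_⟩
    · simp [written]
    · simp [allLeaves]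
    · simp [totalSize, hT]
    · simp [IsNode]
    · simp
  · rintro s' ⟨i, j, acc, win, pos, len, cst, l, E, rfl, -, -, -, hl, -⟩
    have := length_le_totalSize (m := m) (N := N) (B := B) l
    simp [List.length_eq_zero_iff.1 (show l.length = 0 by omega)]
  · rintro a ha s' ⟨i, j, acc, win, pos, len, cst, l, E, rfl, hE, h0, hq, hl, hnode, hpos⟩
    obtain ⟨P, l, rfl⟩ : ∃ P l', l = P :: l' := by
      cases l with
      | nil => simp only [totalSize, List.map_nil, List.sum_nil] at hl; omega
      | cons P l => exact ⟨P, l, rfl⟩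
    refine ⟨by simp, ?_⟩
    have hP : IsNode m N B P := hnode P (by simp)
    have hPlen := hP.length_le
    have hll := length_le_totalSize (m := m) (N := N) (B := B) l
    simp only [totalSize, List.map_cons, List.sum_cons] at hl
    rw [← totalSize] at hl
    have hcost := hP.prefixCost_le
    have hlenP : len a = P.length := hq.head.2.1
    refine reaches_block (k₁ := 50 * (m + 1) ^ 2 + 1) (k₂ := 2) (reaches_ite ?_ ?_) le_rfl
    · intro h
      simp only [val_sub, val_m, val_len, val_head, hm, hlenP] at h
      have hlt : P.length < m := by omega
      rw [treeSize_eq_totalSize hlt] at hl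
      have hcl := length_le_totalSize (m := m) (N := N) (B := B) (children m N B P)
      refine Reaches.imp (reaches_expand (N := N) (B := B) (P := P) hm hmX hB hpref hq.head hlt
        (by simp) (by simp only [List.length_cons]; omega)
        fun c hc => (Nat.add_le_add_right hcost _).trans (hX P c hc)) ?_
      rintro s' ⟨i, j, acc, win, pos, len, cst, rfl, h1, h2⟩
      refine reaches_cons (reaches_set_head (by simp; omega) (reaches_nil ?_))
      refine ⟨i, j, acc, win, pos, len, cst, l ++ children m N B P, E, ?_, ?_, h1 0 ?_ _ h0, ?_,
        ?_, ?_, ?_⟩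
      · simp only [val_add, val_head, val_lit, List.length_cons, List.length_append]
        congr 1
        omega
      · refine List.Perm.trans (List.Perm.append_left _ ?_) hE
        simp only [allLeaves, List.flatMap_append, List.flatMap_cons]
        rw [leaves_eq_allLeaves hlt]
        exact List.perm_append_comm
      · simp
      · refine IsQueue.append (hq.tail.frame (t := a + (l.length + 1)) (by omega) h1) ?_
        rw [show a + 1 + l.length = a + (l.length + 1) by ring]
        exact h2
      · simp only [totalSize, List.map_append, List.sum_append] at hl ⊢
        omega
      · intro P' hP'
        rcases List.mem_append.1 hP' with h' | h'
        · exact hnode P' (by simp [h'])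
        · exact hP.of_mem_children h'
      · omega
    · intro h
      simp only [val_sub, val_m, val_len, val_head, hm, hlenP] at h
      have hlen : P.length = m := by omega
      refine Reaches.imp (reaches_emit (N := N) (P := P) hm hmX hq.head hlen hP.nodup hP.lt) ?_
      rintro s' ⟨i, j, rfl⟩
      refine reaches_cons (reaches_set_head (by simp; omega) (reaches_nil ?_))
      refine ⟨i, j, acc, win, pos, len, cst, l, E ++ [P], ?_, ?_, h0, hq.tail, ?_, ?_, ?_⟩
      · simp only [val_add, val_head, val_lit, List.length_cons, List.length_append]
        congr 1
        · simp
        · omega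
        · rw [List.take_append, written, written, List.flatMap_append, List.append_assoc]
          congr 2
          split_ifs with h0
          · simp [h0]
          · rw [List.take_of_length_le (by simp; omega)]
            simp
      · refine List.Perm.trans ?_ hE
        simp [allLeaves, hlen, leaves]
      · rw [hlen, Nat.sub_self, treeSize] at hl
        omega
      · exact fun P' hP' => hnode P' (by simp [hP'])
      · omega
  · rintro s' ⟨i, j, acc, win, pos, len, cst, l, E, rfl, hE, h0, hq, hl, hnode, hpos⟩
    have hll := length_le_totalSize (m := m) (N := N) (B := B) l
    obtain rfl : l = [] := List.length_eq_zero_iff.1 (by omega)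
    exact reaches_nil ⟨i, j, acc, win, pos, len, cst, _, _, E, rfl, by simpa [allLeaves] using hE, h0⟩

end RAM

namespace Kemeny

open Finset

variable {m : ℕ}

/-! ## Rankings as lists -/

theorem length_encodeRanking (Q : Ranking m) : (encodeRanking Q).length = m := by
  simp [encodeRanking]

theorem getElem_encodeRanking (Q : Ranking m) {c : ℕ} (hc : c < m)
    (h : c < (encodeRanking Q).length) : (encodeRanking Q)[c] = Q.symm ⟨c, hc⟩ := by
  simp [encodeRanking]

theorem encodeRanking_nodup (Q : Ranking m) : (encodeRanking Q).Nodup :=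
  List.nodup_ofFn_ofInjective (Fin.val_injective.comp Q.symm.injective)

theorem mem_encodeRanking (Q : Ranking m) {c : ℕ} : c ∈ encodeRanking Q ↔ c < m := by
  simp only [encodeRanking, List.mem_ofFn]
  constructor
  · rintro ⟨i, rfl⟩; exact (Q.symm i).2
  · intro h; exact ⟨Q ⟨c, h⟩, by simp⟩

theorem encodeRanking_injective : Function.Injective (encodeRanking (m := m)) := by
  intro Q Q' h
  have h1 := List.ofFn_injective h
  have h2 : Q.symm = Q'.symm := by
    ext i
    exact congrFun h1 i
  simpa using congrArg Equiv.symm h2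

theorem exists_encodeRanking {l : List ℕ} (hnd : l.Nodup) (hlen : l.length = m)
    (hlt : ∀ c ∈ l, c < m) : ∃ Q : Ranking m, encodeRanking Q = l := by
  subst hlen
  let f : Fin l.length → Fin l.length := fun i => ⟨l[i], hlt _ (List.getElem_mem _)⟩
  have hf : Function.Injective f := by
    intro i j hij
    exact Fin.ext ((hnd.getElem_inj_iff).1 (congrArg Fin.val hij))
  refine ⟨(Equiv.ofBijective f (Finite.injective_iff_bijective.1 hf)).symm, ?_⟩
  refine List.ext_getElem (by simp [encodeRanking]) fun i h1 h2 => ?_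
  simp [encodeRanking, f]

/-- The list of the candidates of a ranking, the last one first. -/
def chosen (Q : Ranking m) : List ℕ := (encodeRanking Q).reverse

theorem mem_chosen (Q : Ranking m) {c : ℕ} : c ∈ chosen Q ↔ c < m := by
  simp [chosen, mem_encodeRanking]

theorem length_chosen (Q : Ranking m) : (chosen Q).length = m := by
  simp [chosen, length_encodeRanking]

theorem chosen_nodup (Q : Ranking m) : (chosen Q).Nodup :=
  List.nodup_reverse.2 (encodeRanking_nodup Q)

theorem chosen_injective : Function.Injective (chosen (m := m)) :=
  List.reverse_injective.comp encodeRanking_injective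

theorem exists_chosen {P : List ℕ} (hnd : P.Nodup) (hlen : P.length = m)
    (hlt : ∀ c ∈ P, c < m) : ∃ Q : Ranking m, chosen Q = P := by
  obtain ⟨Q, hQ⟩ := exists_encodeRanking (l := P.reverse) (List.nodup_reverse.2 hnd)
    (by simpa using hlen) (by simpa using hlt)
  exact ⟨Q, by rw [chosen, hQ, List.reverse_reverse]⟩

theorem placeIn_chosen (Q : Ranking m) {b : ℕ} (hb : b < m) :
    placeIn (chosen Q) b = place Q b + 1 := by
  have h := place_lt Q hb
  rw [placeIn_eq_succ (chosen_nodup Q) (by rwa [length_chosen])]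
  simp only [chosen, List.reverse_reverse]
  rw [getElem_encodeRanking Q h]
  simp [place, hb]

theorem kendallTau_eq_sum (Q v : Ranking m) : kendallTau Q v =
    ∑ c ∈ range m, ∑ b ∈ range m, if place Q c < place Q b ∧ place v b < place v c then 1 else 0 := by
  rw [kendallTau, Finset.card_filter, Fintype.sum_prod_type, Finset.sum_range]
  refine Finset.sum_congr rfl fun c _ => ?_
  rw [Finset.sum_range]
  refine Finset.sum_congr rfl fun b _ => ?_
  simp [place]

theorem kemenyScore_eq_sum (V : List (Ranking m)) (Q : Ranking m) : kemenyScore V Q =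
    ∑ c ∈ range m, ∑ b ∈ range m, if place Q c < place Q b then prefers V b c else 0 := by
  induction V with
  | nil => simp [kemenyScore, prefers]
  | cons v V ih =>
    have h : kemenyScore (v :: V) Q = kendallTau Q v + kemenyScore V Q := by simp [kemenyScore]
    rw [h, ih, kendallTau_eq_sum, ← Finset.sum_add_distrib]
    refine Finset.sum_congr rfl fun c _ => ?_
    rw [← Finset.sum_add_distrib]
    refine Finset.sum_congr rfl fun b _ => ?_
    by_cases h : place Q c < place Q b <;> simp [h, prefers]

/-- Both sides charge each pair ranked `c` before `b` with the votes that prefer `b` to `c`. -/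
theorem prefixCost_chosen (V : List (Ranking m)) (Q : Ranking m) :
    prefixCost m (prefers V) (chosen Q) = kemenyScore V Q := by
  rw [prefixCost_eq_sum (chosen_nodup Q) (fun c hc => (mem_chosen Q).1 hc) (prefers_self V),
    kemenyScore_eq_sum]
  refine Finset.sum_congr rfl fun c hc => Finset.sum_congr rfl fun b hb => ?_
  rw [Finset.mem_range] at hb hc
  simp [mem_chosen, hc, hb, placeIn_chosen]

theorem mem_leaves_root {N : ℕ → ℕ → ℕ} {B : ℕ} {P : List ℕ} :
    P ∈ leaves m N B m [] ↔ IsNode m N B P ∧ P.length = m := by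
  rw [mem_leaves (by trivial)]
  simp

/-- With the optimal score as budget, the search finds exactly the Kemeny rankings. -/
theorem mem_leaves_iff {V : List (Ranking m)} {Q₀ : Ranking m} (hQ₀ : Q₀ ∈ kemenyRankings V)
    {P : List ℕ} : P ∈ leaves m (prefers V) (kemenyScore V Q₀) m [] ↔
      ∃ Q ∈ kemenyRankings V, chosen Q = P := by
  have hopt : ∀ Q', kemenyScore V Q₀ ≤ kemenyScore V Q' := (Finset.mem_filter.1 hQ₀).2
  rw [mem_leaves_root]
  constructor
  · rintro ⟨h1, h2⟩
    obtain ⟨Q, rfl⟩ := exists_chosen h1.nodup h2 h1.lt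
    have h3 := h1.prefixCost_le
    rw [prefixCost_chosen] at h3
    exact ⟨Q, Finset.mem_filter.2 ⟨Finset.mem_univ _, fun Q' => h3.trans (hopt Q')⟩, rfl⟩
  · rintro ⟨Q, hQ, rfl⟩
    refine ⟨isNode_of_minimal (chosen_nodup Q) (fun c => mem_chosen Q) ?_ ?_, length_chosen Q⟩
    · intro P' hP'
      obtain ⟨Q', rfl⟩ := exists_chosen (m := m) (hP'.nodup_iff.2 (chosen_nodup Q))
        (hP'.length_eq.trans (length_chosen Q)) fun c hc => (mem_chosen Q).1 (hP'.subset hc)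
      rw [prefixCost_chosen, prefixCost_chosen]
      exact (Finset.mem_filter.1 hQ).2 Q'
    · rw [prefixCost_chosen]
      exact (Finset.mem_filter.1 hQ).2 Q₀

theorem leaves_eq_nil {V : List (Ranking m)} {Q₀ : Ranking m} (hQ₀ : Q₀ ∈ kemenyRankings V)
    {B : ℕ} (hB : B < kemenyScore V Q₀) : leaves m (prefers V) B m [] = [] := by
  refine List.eq_nil_iff_forall_not_mem.2 fun P hP => ?_
  rw [mem_leaves_root] at hP
  obtain ⟨Q, rfl⟩ := exists_chosen hP.1.nodup hP.2 hP.1.lt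
  have h := hP.1.prefixCost_le
  rw [prefixCost_chosen] at h
  exact absurd ((Finset.mem_filter.1 hQ₀).2 Q) (by omega)

/-- The search may find the leaves in any order: they are distinct and represent all Kemeny
rankings, so their first `r` form an answer. -/
theorem exists_isAnswer {V : List (Ranking m)} {Q₀ : Ranking m} (hQ₀ : Q₀ ∈ kemenyRankings V)
    {E : List (List ℕ)} (hE : E.Perm (leaves m (prefers V) (kemenyScore V Q₀) m [])) (r : ℕ) :
    ∃ L : List (Ranking m), IsAnswer V r L ∧ L.map chosen = E.take r := by
  have hex : ∀ P ∈ E, ∃ Q ∈ kemenyRankings V, chosen Q = P := fun P hP =>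
    (mem_leaves_iff hQ₀).1 (hE.subset hP)
  obtain ⟨F, hF⟩ : ∃ F : List (Ranking m), F.map chosen = E := by
    have : ∀ P ∈ E, P ∈ Set.range (chosen (m := m)) := fun P hP =>
      let ⟨Q, _, h⟩ := hex P hP
      ⟨Q, h⟩
    change E ∈ Set.range (List.map chosen)
    rwa [Set.range_list_map]
  have hEnd : E.Nodup := hE.nodup_iff.2 (leaves_nodup (by trivial))
  have hFnd : F.Nodup := List.Nodup.of_map _ (hF ▸ hEnd)
  have hmem : ∀ Q, Q ∈ F ↔ Q ∈ kemenyRankings V := by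
    intro Q
    have h1 : Q ∈ F ↔ chosen Q ∈ E := by
      rw [← hF, List.mem_map_of_injective chosen_injective]
    rw [h1, hE.mem_iff, mem_leaves_iff hQ₀]
    constructor
    · rintro ⟨Q', hQ', h⟩
      rwa [← chosen_injective h]
    · exact fun h => ⟨Q, h, rfl⟩
  refine ⟨F.take r, ⟨hFnd.sublist (List.take_sublist r F), fun Q hQ => (hmem Q).1 (List.mem_of_mem_take hQ), ?_⟩, ?_⟩
  · rw [List.length_take, ← List.toFinset_card_of_nodup hFnd]
    congr 2
    ext Q
    simp [hmem]
  · rw [List.map_take, hF]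

/-! ## The optimal score -/

theorem kendallTau_le (Q v : Ranking m) : kendallTau Q v ≤ m ^ 2 := by
  refine (Finset.card_le_univ _).trans ?_
  simp [sq]

theorem kendallTau_self (v : Ranking m) : kendallTau v v = 0 := by
  rw [kendallTau, Finset.card_eq_zero, Finset.filter_eq_empty_iff]
  rintro p - ⟨h1, h2⟩
  exact absurd h1 h2.le.not_gt

theorem kemenyScore_le (V : List (Ranking m)) (Q : Ranking m) :
    kemenyScore V Q ≤ V.length * m ^ 2 := by
  have := List.sum_le_card_nsmul (V.map fun v => kendallTau Q v) (m ^ 2) (by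
    intro x hx
    obtain ⟨v, -, rfl⟩ := List.mem_map.1 hx
    exact kendallTau_le Q v)
  simpa [kemenyScore] using this

theorem exists_mem_kemenyRankings (V : List (Ranking m)) : ∃ Q, Q ∈ kemenyRankings V := by
  obtain ⟨Q, -, hQ⟩ := Finset.exists_min_image Finset.univ (kemenyScore V) Finset.univ_nonempty
  exact ⟨Q, Finset.mem_filter.2 ⟨Finset.mem_univ _, fun Q' => hQ Q' (Finset.mem_univ _)⟩⟩

/-- Each vote has a score of at least `opt` as a ranking, so the double sum is at least `n * opt`
and `d ≥ opt / (n - 1) ≥ opt / n`. For one vote the vote itself shows `opt = 0`. -/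
theorem kemenyScore_div_le_avgKT {V : List (Ranking m)} (hV : V ≠ []) {Q : Ranking m}
    (hQ : Q ∈ kemenyRankings V) : (kemenyScore V Q : ℝ) / V.length ≤ avgKT V := by
  have hopt : ∀ Q', kemenyScore V Q ≤ kemenyScore V Q' := (Finset.mem_filter.1 hQ).2
  have hpos : 1 ≤ V.length := List.length_pos_iff.2 hV
  rcases hpos.eq_or_lt with h1 | h1
  · obtain ⟨v, rfl⟩ := List.length_eq_one_iff.1 h1.symm
    have : kemenyScore [v] Q = 0 := by
      have := hopt v
      simpa [kemenyScore, kendallTau_self] using this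
    simp [this, avgKT]
  · have hn : (2 : ℝ) ≤ V.length := by exact_mod_cast h1
    have h2 : (V.length : ℝ) * kemenyScore V Q ≤
        (V.map fun v => (V.map fun w => (kendallTau v w : ℝ)).sum).sum := by
      have := List.card_nsmul_le_sum
        (V.map fun v => (V.map fun w => (kendallTau v w : ℝ)).sum) (kemenyScore V Q : ℝ) (by
        intro x hx
        obtain ⟨v, -, rfl⟩ := List.mem_map.1 hx
        have h3 : ((kemenyScore V v : ℕ) : ℝ) = (V.map fun w => (kendallTau v w : ℝ)).sum := by
          rw [kemenyScore, Nat.cast_list_sum, List.map_map]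
          rfl
        rw [← h3]
        exact_mod_cast hopt v)
      simpa using this
    rw [avgKT, div_le_div_iff₀ (by linarith) (by nlinarith)]
    have h4 : (0 : ℝ) ≤ kemenyScore V Q := Nat.cast_nonneg _
    nlinarith

end Kemeny

/-! ### Reading the votes into the matrix of preferences. -/

namespace RAM

open Kemeny

variable {X : ℕ} {s : Store} {m : ℕ}

/-- Contribution of a vote to the number of votes that prefer `x` to `y`, when the pairs with the
second candidate in front of the position `b`, and those with the first one in front of the
position `c` and the second one at the position `b`, have been counted. -/
def counted (v : Ranking m) (b c x y : ℕ) : ℕ :=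
  if place v x < place v y ∧ (place v y < b ∨ (place v y = b ∧ place v x < c)) then 1 else 0

theorem place_getElem_encodeRanking (v : Ranking m) {c : ℕ} (h : c < (encodeRanking v).length) :
    place v (encodeRanking v)[c] = c := by
  have hc : c < m := by rwa [length_encodeRanking] at h
  rw [getElem_encodeRanking v hc]
  simp [place]

theorem getElem_encodeRanking_lt (v : Ranking m) {c : ℕ} (h : c < (encodeRanking v).length) :
    (encodeRanking v)[c] < m := (mem_encodeRanking v).1 (List.getElem_mem h)

theorem pair_index_eq_iff {x y x' y' : ℕ} (hy : y < m) (hy' : y' < m) :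
    x * m + y = x' * m + y' ↔ x = x' ∧ y = y' := by
  constructor
  · intro h
    have h1 : x = x' := by
      rcases lt_trichotomy x x' with h' | h' | h'
      · have := row_index_lt h' hy; omega
      · exact h'
      · have := row_index_lt h' hy'; omega
    subst h1
    exact ⟨rfl, by omega⟩
  · rintro ⟨rfl, rfl⟩; rfl

/-- When the candidate at position `b` of a vote arrives, the entry for each earlier candidate of
that vote over it is increased by one. -/
theorem reaches_readVotes {V : List (Ranking m)} (hm : s.m = m) (hmX : m < X) (hi : s.i = 0)
    (hn : s.n = V.length) (hVX : V.length ≤ X) (hinp : s.inp = V.flatMap encodeRanking)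
    (hpref : ∀ x, s.pref x = 0) :
    Reaches X readVotes s (V.length * (m * (m * 4 + 6) + 5) + 1) fun s' => ∃ i j k seq pref inp,
      s' = { s with i := i, j := j, k := k, seq := seq, pref := pref, inp := inp } ∧
      ∀ x < m, ∀ y < m, pref (x * m + y) = prefers V x y := by
  refine Reaches.imp (reaches_loop (k := m * (m * 4 + 6) + 4) V.length (fun a s' =>
    ∃ j k seq pref, s' = { s with i := a, j := j, k := k, seq := seq, pref := pref,
                                  inp := (V.drop a).flatMap encodeRanking } ∧
      ∀ x < m, ∀ y < m, pref (x * m + y) = prefers (V.take a) x y) ?_ ?_ ?_) ?_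
  · exact ⟨s.j, s.k, s.seq, s.pref, by cases s; simp_all, by simp [hpref, prefers]⟩
  · rintro s' ⟨j, k, seq, pref, rfl, -⟩; simp [hn]
  · rintro a ha s' ⟨j, k, seq, pref, rfl, hp⟩
    refine ⟨by simp [hn]; omega, ?_⟩
    set v := V[a] with hv
    refine reaches_cons (reaches_set_j (by simp) ?_)
    refine reaches_block (k₁ := m * (m * 4 + 6) + 1) (k₂ := 2) ?_ (by omega)
    refine Reaches.imp (reaches_loop (k := m * 4 + 5) m (fun b s' =>
      ∃ k seq pref,
        s' = { s with i := a, j := b, k := k, seq := seq, pref := pref,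
                      inp := (encodeRanking v).drop b ++
                        (V.drop (a + 1)).flatMap encodeRanking } ∧
        (∀ c (hc : c < (encodeRanking v).length), c < b → seq c = (encodeRanking v)[c]) ∧
        ∀ x < m, ∀ y < m, pref (x * m + y) =
          prefers (V.take a) x y + counted v b 0 x y) ?_ ?_ ?_) ?_
    · refine ⟨k, seq, pref, ?_, by simp, fun x hx y hy => ?_⟩
      · rw [List.drop_eq_getElem_cons ha, List.flatMap_cons]
        simp [hv]
      · rw [hp x hx y hy]
        simp [counted]
    · rintro s' ⟨k, seq, pref, rfl, -⟩; simp [hm]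
    · rintro b hb s' ⟨k, seq, pref, rfl, hseq, hpr⟩
      refine ⟨by simp [hm]; omega, ?_⟩
      have hbl : b < (encodeRanking v).length := by rwa [length_encodeRanking]
      refine reaches_cons (reaches_read_seq (x := (encodeRanking v)[b])
        (l := (encodeRanking v).drop (b + 1) ++ (V.drop (a + 1)).flatMap encodeRanking) ?_ ?_)
      · rw [List.drop_eq_getElem_cons hbl, List.cons_append]
      refine reaches_cons (reaches_set_k (by simp) ?_)
      refine reaches_block (k₁ := m * 4 + 1) (k₂ := 2) ?_ (by omega)
      refine Reaches.weaken (k := b * 4 + 1) ?_ (by omega)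
      have hseq' : ∀ c (hc : c < (encodeRanking v).length), c < b + 1 →
          Function.update seq b (encodeRanking v)[b] c = (encodeRanking v)[c] := by
        intro c hc hcb
        rw [Function.update_apply]
        split_ifs with h
        · simp only [h]
        · exact hseq c hc (by omega)
      simp only [val_j, val_lit]
      refine Reaches.imp (reaches_loop (k := 3) b (fun c s' =>
        ∃ pref,
          s' = { s with i := a, j := b, k := c, pref := pref,
                        seq := Function.update seq b (encodeRanking v)[b],
                        inp := (encodeRanking v).drop (b + 1) ++
                          (V.drop (a + 1)).flatMap encodeRanking } ∧
          ∀ x < m, ∀ y < m, pref (x * m + y) =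
            prefers (V.take a) x y + counted v b c x y) ?_ ?_ ?_) ?_
      · exact ⟨pref, rfl, hpr⟩
      · rintro s' ⟨pref, rfl, -⟩; simp
      · rintro c hc s' ⟨pref, rfl, hpr⟩
        refine ⟨by simp; omega, ?_⟩
        have hcl : c < (encodeRanking v).length := by omega
        have e1 := hseq' c hcl (by omega)
        have e2 := hseq' b hbl (by omega)
        have p1 := place_getElem_encodeRanking v hcl
        have p2 := place_getElem_encodeRanking v hbl
        have l1 := getElem_encodeRanking_lt v hcl
        have l2 := getElem_encodeRanking_lt v hbl
        have h0 := hpr _ l1 _ l2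
        -- The current vote has not yet been counted for this pair, so the entry is at most `a < n`
        -- and may be increased without exceeding `X`.
        rw [counted, if_neg (by omega)] at h0
        have h1 : prefers (V.take a) (encodeRanking v)[c] (encodeRanking v)[b] ≤ a :=
          (prefers_le _ _ _).trans (by simp)
        refine reaches_cons (reaches_store_pref ?_ ?_)
        · simp only [val_add, val_prefAt, val_seq, val_k, val_j, val_lit, e1, e2, hm, h0]
          omega
        refine reaches_cons (reaches_set_k (by simp; omega) (reaches_nil ?_))
        simp only [val_add, val_mul, val_m, val_prefAt, val_seq, val_k, val_j, val_lit, e1, e2, hm,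
          h0]
        refine ⟨_, rfl, fun x hx y hy => ?_⟩
        have hxy : x * m + y = (encodeRanking v)[c] * m + (encodeRanking v)[b] ↔
            place v x = c ∧ place v y = b := by
          rw [pair_index_eq_iff hy l2]
          constructor
          · rintro ⟨rfl, rfl⟩; exact ⟨p1, p2⟩
          · rintro ⟨q1, q2⟩
            exact ⟨place_injOn v hx l1 (q1.trans p1.symm), place_injOn v hy l2 (q2.trans p2.symm)⟩
        rw [Function.update_apply]
        split_ifs with h
        · obtain ⟨rfl, rfl⟩ := (pair_index_eq_iff hy l2).1 h
          simp only [counted]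
          rw [if_pos (by omega)]
        · rw [hxy] at h
          rw [hpr x hx y hy]
          simp only [counted]
          congr 2
          rw [eq_iff_iff]
          omega
      · rintro s' ⟨pref, rfl, hpr⟩
        refine reaches_cons (reaches_set_j (by simp; omega) (reaches_nil ?_))
        simp only [val_add, val_j, val_lit]
        refine ⟨_, _, _, rfl, hseq', fun x hx y hy => ?_⟩
        rw [hpr x hx y hy]
        simp only [counted]
        congr 2
        rw [eq_iff_iff]
        omega
    · rintro s' ⟨k, seq, pref, rfl, -, hpr⟩
      refine reaches_cons (reaches_set_i (by simp; omega) (reaches_nil ?_))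
      refine ⟨m, k, seq, pref, ?_, fun x hx y hy => ?_⟩
      · rw [List.drop_of_length_le (by rw [length_encodeRanking])]
        simp
      · rw [hpr x hx y hy, List.take_succ_eq_append_getElem ha]
        -- After the whole vote `b = m`, which exceeds every position, so the condition on positions
        -- in `counted` has become vacuous.
        have := place_lt v hy
        simp [prefers, counted, ← hv, this]
  · rintro s' ⟨j, k, seq, pref, rfl, hp⟩
    exact ⟨_, j, k, seq, pref, _, rfl, by simpa using hp⟩

end RAM

/-! ### The complete program and its running time. -/

namespace RAM

open Kemeny

theorem size_le_bitSize {l : List ℕ} {x : ℕ} (h : x ∈ l) : Nat.size x ≤ bitSize l := by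
  have := List.single_le_sum (l := l.map fun x => Nat.size x + 1) (fun _ _ => Nat.zero_le _) _
    (List.mem_map_of_mem h)
  exact (Nat.le_succ _).trans this

theorem length_le_bitSize (l : List ℕ) : l.length ≤ bitSize l := by
  induction l with
  | nil => simp
  | cons x l ih => simp only [bitSize, List.map_cons, List.sum_cons, List.length_cons] at ih ⊢; omega

variable {m : ℕ}

theorem length_mul_le_bitSize (V : List (Ranking m)) (r : ℕ) :
    V.length * m + 3 ≤ bitSize (encodeInstance V r) := by
  refine le_trans (le_of_eq ?_) (length_le_bitSize _)
  simp [encodeInstance, List.length_flatMap, length_encodeRanking]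

theorem written_map_chosen (L : List (Ranking m)) : written m (L.map chosen) = encodeAnswer L := by
  simp [written, encodeAnswer, chosen, List.flatMap_map]

/-- The memory at the beginning. -/
def initialStore (inp : List ℕ) : Store :=
  { m := 0, n := 0, r := 0, i := 0, j := 0, k := 0, bud := 0, go := 0, head := 0, tail := 0,
    win := 0, acc := 0, seq := fun _ => 0, pref := fun _ => 0, pos := fun _ => 0,
    len := fun _ => 0, cst := fun _ => 0, inp := inp, out := [] }

theorem initialStore_state (inp : List ℕ) : (initialStore inp).state = ⟨fun _ => 0, inp, []⟩ := by
  have : (initialStore inp).mem = fun _ => 0 := by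
    funext a
    simp only [Store.mem]
    generalize a % 8 = q
    generalize a / 8 = x
    rcases q with _ | _ | _ | _ | _ | _ | q
    · rcases x with _ | _ | _ | _ | _ | _ | _ | _ | _ | _ | _ | _ | x <;> rfl
    all_goals rfl
  rw [Store.state, this]
  rfl

theorem stepCost_prefers_le (V : List (Ranking m)) (P : List ℕ) (c : ℕ) :
    stepCost m (prefers V) P c ≤ V.length * m := by
  have : stepCost m (prefers V) P c ≤ ∑ b ∈ Finset.range m, V.length := by
    refine Finset.sum_le_sum fun b _ => ?_
    split_ifs
    · exact Nat.zero_le _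
    · exact prefers_le V b c
  simpa [mul_comm] using this

/-- The whole program, with all numbers bounded by `X` and all search trees of size at most `S`. -/
theorem reaches_kemenyProgram {X S : ℕ} {V : List (Ranking m)} {r : ℕ} {Q₀ : Ranking m}
    (hQ₀ : Q₀ ∈ kemenyRankings V) (hmX : m < X) (hnX : V.length ≤ X) (hrX : r ≤ X)
    (hS : ∀ B ≤ kemenyScore V Q₀, treeSize m (prefers V) B m [] ≤ S) (hSX : S ≤ X)
    (hX : kemenyScore V Q₀ + V.length * m < X) :
    Reaches X kemenyProgram (initialStore (encodeInstance V r))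
      (V.length * m * (m * 4 + 11) + 20 +
        (kemenyScore V Q₀ + 1) * (S * (50 * (m + 1) ^ 2 + 4) + 10)) fun s' =>
      ∃ L : List (Ranking m), IsAnswer V r L ∧ s'.out = encodeAnswer L := by
  obtain ⟨W, hWlen, hWinp, hWX, hWpref⟩ : ∃ W : List (Ranking m),
      W.length = V.length * (1 - (1 - m)) ∧
      W.flatMap encodeRanking = V.flatMap encodeRanking ∧ W.length ≤ V.length * m ∧
      ∀ x < m, ∀ y < m, prefers W x y = prefers V x y := by
    rcases Nat.eq_zero_or_pos m with rfl | h
    · exact ⟨[], by simp, by simp [encodeRanking], by simp, by simp⟩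
    · refine ⟨V, ?_, rfl, Nat.le_mul_of_pos_right _ h, fun _ _ _ _ => rfl⟩
      rw [show 1 - (1 - m) = 1 by omega, mul_one]
  have hWt : W.length * (m * (m * 4 + 6) + 5) ≤ V.length * m * (m * 4 + 11) := by
    rcases Nat.eq_zero_or_pos m with rfl | h
    · simp at hWlen; simp [hWlen]
    · rw [show 1 - (1 - m) = 1 by omega, mul_one] at hWlen
      rw [hWlen, mul_assoc]
      exact Nat.mul_le_mul_left _ (by nlinarith)
  set opt := kemenyScore V Q₀ with hopt
  refine Reaches.weaken (k := W.length * (m * (m * 4 + 6) + 5) + 1 +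
    ((opt + 1) * (S * (50 * (m + 1) ^ 2 + 4) + 10) + 1 + 1 + 1) + 4) ?_ (by omega)
  refine reaches_cons (reaches_read_m (x := m)
    (l := V.length :: r :: V.flatMap encodeRanking) rfl ?_)
  refine reaches_cons (reaches_read_n (x := V.length) (l := r :: V.flatMap encodeRanking) rfl ?_)
  refine reaches_cons (reaches_read_r (x := r) (l := V.flatMap encodeRanking) rfl ?_)
  refine reaches_cons (reaches_set_n ?_ ?_)
  · simp only [val_mul, val_n, val_sub, val_lit, val_m, ← hWlen]
    omega
  simp only [val_mul, val_n, val_sub, val_lit, val_m, ← hWlen]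
  refine reaches_block (Reaches.imp (reaches_readVotes (V := W) rfl hmX rfl rfl (by omega)
    hWinp.symm fun _ => rfl) ?_) le_rfl
  rintro s' ⟨i, j, k, seq, pref, inp, rfl, hpref⟩
  refine reaches_cons (reaches_set_go (by simpa using hrX) ?_)
  simp only [val_r]
  have hpref' : ∀ x < m, ∀ y < m, pref (x * m + y) = prefers V x y := fun x hx y hy =>
    (hpref x hx y hy).trans (hWpref x hx y hy)
  refine reaches_block (k₁ := (opt + 1) * (S * (50 * (m + 1) ^ 2 + 4) + 9 + 1) + 1) (k₂ := 1)
    ?_ le_rfl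
  rcases Nat.eq_zero_or_pos r with rfl | hr
  · refine Reaches.imp (Reaches.weaken (reaches_loop (k := 0) 0
      (fun _ s' => s'.go = 0 ∧ s'.out = []) ⟨rfl, rfl⟩ ?_ ?_) (by omega)) ?_
    · rintro s' ⟨h, -⟩; simpa using h
    · intro c hc; omega
    · rintro s' ⟨-, h⟩
      exact reaches_nil ⟨[], ⟨List.nodup_nil, by simp, by simp⟩, by simpa [encodeAnswer] using h⟩
  · refine Reaches.imp (reaches_loop (opt + 1) (fun a s' =>
      (a ≤ opt → ∃ i j acc win pos len cst head tail,
        s' = { initialStore inp with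
          m := m, n := W.length, r := r, i := i, j := j, k := k, bud := a, go := r, head := head,
          tail := tail, win := win, acc := acc, seq := seq, pref := pref, pos := pos, len := len,
          cst := cst } ∧ IsRow m (prefers V) s' 0 []) ∧
      (a = opt + 1 → s'.go = 0 ∧ ∃ L : List (Ranking m), IsAnswer V r L ∧
        s'.out = encodeAnswer L)) ?_ ?_ ?_) ?_
    · refine ⟨fun _ => ⟨_, _, _, _, _, _, _, _, _, rfl, ?_⟩, by simp⟩
      -- Memory filled with zeros already represents the empty initial part as node `0`.
      simp [IsRow, initialStore, placeIn, prefixCost]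
    · rintro s' ⟨-, h⟩
      simpa using (h rfl).1
    · rintro c hc s' ⟨h, -⟩
      obtain ⟨i, j, acc, win, pos, len, cst, head, tail, rfl, hrow⟩ := h (by omega)
      refine ⟨by simp; omega, ?_⟩
      have hSc := hS c (by omega)
      refine reaches_block (k₁ := S * (50 * (m + 1) ^ 2 + 4) + 5) (k₂ := 4) ?_ (by omega)
      refine Reaches.imp (Reaches.weaken (reaches_search (m := m) (N := prefers V) (B := c) rfl hmX rfl
        hpref' hrow rfl (hSc.trans hSX) fun P x _ => ?_)
        (Nat.add_le_add_right (Nat.mul_le_mul_right _ hSc) _)) ?_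
      · have := stepCost_prefers_le V P x
        omega
      rintro s' ⟨i, j, acc, win, pos, len, cst, head, tail, E, rfl, hE, hrow⟩
      refine reaches_cons (reaches_set_bud (by simp; omega) (reaches_nil ?_))
      refine ⟨fun hco => ?_, fun hco => ?_⟩
      · rw [leaves_eq_nil hQ₀ (by omega), List.perm_nil] at hE
        subst hE
        exact ⟨i, j, acc, win, pos, len, cst, head, tail, by simp [written, initialStore], hrow⟩
      · obtain rfl : c = opt := by omega
        have hne : E ≠ [] := by
          rintro rfl
          have := (mem_leaves_iff hQ₀).2 ⟨Q₀, hQ₀, rfl⟩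
          simpa using hE.symm.subset this
        obtain ⟨L, hL, hLE⟩ := exists_isAnswer hQ₀ hE r
        refine ⟨by simp [hne], L, hL, ?_⟩
        rw [← written_map_chosen, hLE]
        simp [initialStore]
    · rintro s' ⟨-, h⟩
      exact reaches_nil (h rfl).2

/-- The bound for the sizes of the search trees. -/
theorem treeSize_root_le {V : List (Ranking m)} (hV : V ≠ []) {Q₀ : Ranking m} {B : ℕ}
    (hB : B ≤ kemenyScore V Q₀) : (treeSize m (prefers V) B m [] : ℝ) ≤
      (m + 1) * (16 : ℝ) ^ ((kemenyScore V Q₀ : ℝ) / V.length) := by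
  refine (treeSize_le hV (P := []) (by simp [prefixCost])).trans ?_
  gcongr
  · norm_num
  · simpa [prefixCost] using hB

/-- Estimate of the number of operations; `M` exceeds the size of the input. -/
theorem steps_le {n m M o S : ℕ} (hmM : m + 1 ≤ M) (hnmM : n * m + 4 ≤ M) (ho : o ≤ n * m * m) :
    n * m * (m * 4 + 11) + 20 + (o + 1) * (S * (50 * (m + 1) ^ 2 + 4) + 10) ≤
      120 * M ^ 4 * (S + 1) := by
  have hM : 4 ≤ M := by omega
  have h1 : n * m * (m * 4 + 11) ≤ M * (11 * M) := Nat.mul_le_mul (by omega) (by omega)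
  have h2 : o + 1 ≤ M ^ 2 := by nlinarith
  have h3 : (m + 1) ^ 2 ≤ M ^ 2 := Nat.pow_le_pow_left hmM 2
  have h4 : S * (50 * (m + 1) ^ 2 + 4) + 10 ≤ (S + 1) * (60 * M ^ 2) := by nlinarith
  have h5 : (o + 1) * (S * (50 * (m + 1) ^ 2 + 4) + 10) ≤ M ^ 2 * ((S + 1) * (60 * M ^ 2)) :=
    Nat.mul_le_mul h2 h4
  have h6 : M * (11 * M) + 20 ≤ 60 * M ^ 4 := by nlinarith [Nat.pow_le_pow_left hM 2]
  have h7 : 60 * M ^ 4 ≤ 60 * M ^ 4 * (S + 1) := Nat.le_mul_of_pos_right _ (by omega)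
  nlinarith

theorem lt_two_pow_of_lt {a b : ℕ} (h : a < b) : a < 2 ^ b := h.trans Nat.lt_two_pow_self

theorem opCost_two_pow_le {M : ℕ} (hM : 1 ≤ M) : opCost (2 ^ (4 * M ^ 2)) ≤ 60000 * M ^ 2 := by
  rw [opCost, Nat.size_pow]
  nlinarith

/-- Estimate of the size of the search trees by a power of two. -/
theorem floor_le_two_pow {m : ℕ} {x : ℝ} (hx : x ≤ (m ^ 2 : ℕ)) :
    ⌊(m + 1) * (16 : ℝ) ^ x⌋₊ ≤ 2 ^ (m + 4 * m ^ 2) := by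
  have h1 : (16 : ℝ) ^ x ≤ 2 ^ (4 * m ^ 2) := by
    refine (Real.rpow_le_rpow_of_exponent_le (by norm_num) hx).trans (le_of_eq ?_)
    rw [Real.rpow_natCast, pow_mul]
    norm_num
  have h2 : ((m + 1 : ℕ) : ℝ) ≤ 2 ^ m := by exact_mod_cast Nat.lt_two_pow_self
  refine Nat.floor_le_of_le ?_
  push_cast at h2 ⊢
  rw [pow_add]
  exact mul_le_mul h2 h1 (by positivity) (by positivity)

/-- A run of the program, where `M` exceeds the size of the input and `S` bounds the sizes of the
search trees. -/
theorem exists_run {V : List (Ranking m)} {r M S : ℕ} {Q₀ : Ranking m} (hV : V ≠ [])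
    (hQ₀ : Q₀ ∈ kemenyRankings V) (hM : bitSize (encodeInstance V r) + 1 = M)
    (hS : ∀ B ≤ kemenyScore V Q₀, treeSize m (prefers V) B m [] ≤ S)
    (hS' : S ≤ 2 ^ (m + 4 * m ^ 2)) :
    ∃ (L : List (Ranking m)) (t : ℕ), IsAnswer V r L ∧
      Computes kemenyProgram (encodeInstance V r) (encodeAnswer L) t ∧
      t ≤ 120 * M ^ 4 * (S + 1) * (60000 * M ^ 2) := by
  have hn : 1 ≤ V.length := List.length_pos_iff.2 hV
  have hN := length_mul_le_bitSize V r
  have hmn : m ≤ V.length * m := Nat.le_mul_of_pos_left m hn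
  have hopt : kemenyScore V Q₀ ≤ V.length * m * m := by
    have := kemenyScore_le V Q₀
    rwa [sq, ← mul_assoc] at this
  have hmM2 : m * m ≤ M * M := Nat.mul_le_mul (by omega) (by omega)
  have hnM2 : V.length * m * m ≤ M * M := Nat.mul_le_mul (by omega) (by omega)
  have hMM : M ≤ M * M := Nat.le_mul_of_pos_left M (by omega)
  -- The bound `X = 2 ^ (4 * M ^ 2)` must cover the node numbers, which may reach `S ≤ 2 ^ (m + 4 *
  -- m ^ 2)`. At logarithmic cost this makes an operation quadratic in `M`.
  have hpow : ∀ {k : ℕ}, k ≤ 4 * M ^ 2 → 2 ^ k ≤ 2 ^ (4 * M ^ 2) := fun h =>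
    Nat.pow_le_pow_right (by norm_num) h
  have hSX : S ≤ 2 ^ (4 * M ^ 2) := by
    have : (m + 1) * (m + 1) ≤ M * M := Nat.mul_le_mul (by omega) (by omega)
    refine hS'.trans (hpow ?_)
    rw [sq, sq]
    linarith
  have hinX : ∀ y ∈ encodeInstance V r, y ≤ 2 ^ (4 * M ^ 2) := by
    intro y hy
    have h1 := size_le_bitSize hy
    refine (Nat.lt_size_self y).le.trans (hpow ?_)
    rw [sq]
    omega
  have hoptX : kemenyScore V Q₀ + V.length * m < 2 ^ (4 * M ^ 2) := by
    refine lt_two_pow_of_lt ?_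
    rw [sq]
    omega
  have hmX : m < 2 ^ (4 * M ^ 2) := lt_of_le_of_lt (by omega) hoptX
  have hrun := reaches_kemenyProgram (r := r) hQ₀ hmX (hinX _ (by simp [encodeInstance]))
    (hinX _ (by simp [encodeInstance])) hS hSX hoptX
  obtain ⟨s', t, h1, h2, -, L, hL, hout⟩ := hrun ⟨fun a => by
    have := congrArg (fun s : State => s.mem a) (initialStore_state (encodeInstance V r))
    simp only [Store.state] at this
    rw [this]
    exact Nat.zero_le _, hinX⟩
  rw [initialStore_state] at h1
  exact ⟨L, t, hL, ⟨_, h1, hout⟩, h2.trans (Nat.mul_le_mul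
    (steps_le (by omega) (by omega) hopt) (opCost_two_pow_le (by omega)))⟩

end RAM

open RAM Kemeny in
/-- **Distinct OPT Kemeny Ranking Aggregation in time `O*(16 ^ d)`**, where `d` is the average
Kendall–Tau distance of the votes: one program and one polynomial `q` work for all instances, and
the running time is at most `16 ^ d` times `q` of the binary size of the input. -/
theorem mainTheorem3 :
    ∃ (P : RAM.Program) (q : Polynomial ℕ),
      ∀ (m : ℕ) (V : List (Kemeny.Ranking m)) (r : ℕ), V ≠ [] →
        ∃ (L : List (Kemeny.Ranking m)) (t : ℕ),
          Kemeny.IsAnswer V r L ∧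
          RAM.Computes P (Kemeny.encodeInstance V r) (Kemeny.encodeAnswer L) t ∧
          (t : ℝ) ≤ (16 : ℝ) ^ Kemeny.avgKT V *
            ((q.eval (Kemeny.bitSize (Kemeny.encodeInstance V r)) : ℕ) : ℝ) := by
  -- The coefficient is `120 * 60000 * 2`. The exponent is `4 + 2 + 1`: number of steps per tree
  -- node, cost of one operation, and the factor `m + 1 ≤ M` in the tree size; the `2` absorbs the
  -- `1` in `S + 1`.
  refine ⟨kemenyProgram, Polynomial.C 14400000 * (Polynomial.X + 1) ^ 7, fun m V r hV => ?_⟩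
  obtain ⟨Q₀, hQ₀⟩ := exists_mem_kemenyRankings V
  obtain ⟨M, hM⟩ : ∃ M, bitSize (encodeInstance V r) + 1 = M := ⟨_, rfl⟩
  obtain ⟨x, hx⟩ : ∃ x : ℝ, x = (kemenyScore V Q₀ : ℝ) / V.length := ⟨_, rfl⟩
  have hn : 1 ≤ V.length := List.length_pos_iff.2 hV
  have hn' : (0 : ℝ) < V.length := by exact_mod_cast hn
  have hx0 : 0 ≤ x := by rw [hx]; positivity
  have hxm : x ≤ (m ^ 2 : ℕ) := by
    rw [hx, div_le_iff₀ hn', mul_comm]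
    exact_mod_cast kemenyScore_le V Q₀
  have hmM : m + 1 ≤ M := by
    have h1 := length_mul_le_bitSize V r
    have h2 := Nat.le_mul_of_pos_left m hn
    omega
  obtain ⟨S, hS⟩ : ∃ S, S = ⌊(m + 1) * (16 : ℝ) ^ x⌋₊ := ⟨_, rfl⟩
  have hSr : (S : ℝ) ≤ (m + 1) * (16 : ℝ) ^ x := hS ▸ Nat.floor_le (by positivity)
  obtain ⟨L, t, hL, hrun, ht⟩ := exists_run (S := S) hV hQ₀ hM
    (fun B hB => hS ▸ Nat.le_floor (hx ▸ treeSize_root_le hV hB)) (hS ▸ floor_le_two_pow hxm)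
  refine ⟨L, t, hL, hrun, ?_⟩
  have hS1 : ((S + 1 : ℕ) : ℝ) ≤ 2 * M * (16 : ℝ) ^ avgKT V := by
    have h16 : (16 : ℝ) ^ x ≤ (16 : ℝ) ^ avgKT V :=
      Real.rpow_le_rpow_of_exponent_le (by norm_num) (hx ▸ kemenyScore_div_le_avgKT hV hQ₀)
    have h1x : 1 ≤ (16 : ℝ) ^ x := Real.one_le_rpow (by norm_num) hx0
    have hmM' : (m + 1 : ℝ) ≤ M := by exact_mod_cast hmM
    have h1 : (1 : ℝ) ≤ M * (16 : ℝ) ^ avgKT V :=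
      one_le_mul_of_one_le_of_one_le (by exact_mod_cast (by omega : 1 ≤ M)) (h1x.trans h16)
    have h2 : (m + 1) * (16 : ℝ) ^ x ≤ M * (16 : ℝ) ^ avgKT V := by gcongr
    push_cast
    linarith
  have ht' : (t : ℝ) ≤ ((120 * M ^ 4 * (S + 1) * (60000 * M ^ 2) : ℕ) : ℝ) := Nat.cast_le.2 ht
  have hq : Polynomial.eval (bitSize (encodeInstance V r))
      (Polynomial.C 14400000 * (Polynomial.X + 1) ^ 7) = 14400000 * M ^ 7 := by
    simp only [Polynomial.eval_mul, Polynomial.eval_C, Polynomial.eval_pow,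
      Polynomial.eval_add, Polynomial.eval_X, Polynomial.eval_one, hM]
  calc (t : ℝ) ≤ 7200000 * (M : ℝ) ^ 6 * ((S + 1 : ℕ) : ℝ) := by
        refine ht'.trans (le_of_eq ?_)
        push_cast
        ring
    _ ≤ 7200000 * (M : ℝ) ^ 6 * (2 * M * (16 : ℝ) ^ avgKT V) :=
        mul_le_mul_of_nonneg_left hS1 (by positivity)
    _ = _ := by
        rw [hq]
        push_cast
        ring
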